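/- **Setting.** Records are real numbers in $[0,1]$. A dataset $D=(D_1,\dots,D_n)$, $n\ge 1$, consists of independent records $D_i\sim\chi_i$; we write $\chi=(\chi_1,\dots,\chi_n)$ and $D\sim\chi$. Its rank function is $r_D(x)=\#\{i: D_i<x\}$, and $r_\chi(x)=\mathbb E_{D\sim\chi}[r_D(x)]$. The distribution function of a distribution $\mu$ is $F_\mu(x)=\mu((-\infty,x))$, that is, $r_\chi/n$ for i.i.d. records (the usual c.d.f. away from atoms). $\|\cdot\|_\infty$ is the supremum over $x\in[0,1]$. **Machine.** Algorithms are programs for a real RAM: natural-number registers and memory cells that hold words, real registers, constants, arithmetic, comparison of two numbers of the same kind, rounding a nonnegative real down to a word, and random read access to the $n$ records, which are given as a sorted array. Each instruction is one operation. **Distribution learnability (rank operation).** For each $n\ge1$ fix a set of admissible families $\chi=(\chi_1,\dots,\chi_n)$. These are *distribution learnable for the rank operation* with parameters $O(\mathcal T_n)$, $O(\mathcal S_n)$, $O(\mathcal B_n)$, accuracy constants $\varkappa_1,\varkappa_2$ and a constant $C$ for the $O(\cdot)$, if there are a training program and an evaluation program, the same for all $n\ge1$, using words of at most $C\log_2(n+\mathcal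 S_n)$ bits, such that: * (Training) for every dataset of size $n$ (given sorted), training halts after at most $C\,n\mathcal B_n$ operations and outputs a model, a list of words; the bits of this list plus the length of the evaluation program number at most $C\,\mathcal S_n$ (the dataset itself is not counted); * (Inference) for every $x\in[0,1]$, the evaluation program, given $x$, the model and read access to the sorted dataset, returns a value $\hat f(x)$ after at most $C\,\mathcal T_n$ operations; * (Accuracy) for every admissible $\chi$ and every $\epsilon\ge\sqrt n$, $$\mathbb P_{D\sim\chi}\big[\|r_\chi-\hat f\|_\infty\ge\epsilon\big]\le\varkappa_1e^{-\varkappa_2(\epsilon/\sqrt n-1)^2}.$$ **Lemma.** There are universal constants $\varkappa_1,\varkappa_2>0$ and $C$ such that the following hold. 1. For every real $\rho\ge1$ let $\mathfrak X_\rho$ be the class of distributions on $[0,1]$ with a p.d.f. bounded by $\rho$. The families with all $\chi_i\in\mathfrak X_\rho$ are distribution learnable for the rank operation with constants $\varkappa_1,\varkappa_2,C$ and $$\mathcal T_n=1,\qquad \mathcal S_n=n\mathcal B_n=\rho\sqrt n\,\log(n+1).$$ 2. For every integer $l\ge1$ let $\mathfrak X_l$ be the class of distributions on $[0,1]$ whose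 distribution function is piecewise linear on $[0,1]$ with at most $l$ pieces. The families with all $\chi_i\in\mathfrak X_l$ and $\frac1n\sum_i\chi_i\in\mathfrak X_l$ (in particular, i.i.d. records from a member of $\mathfrak X_l$) are distribution learnable for the rank operation with constants $\varkappa_1,\varkappa_2,C$ and $$\mathcal T_n=\log(l+1),\qquad \mathcal S_n=l\log(n+1),\qquad n\mathcal B_n=n\log(n+1).$$ 3. Let $\mu$ be a distribution on $[0,1]$ whose distribution function is computed on $[0,1]$ by a program of the above kind, without a dataset, in a bounded number of operations on words of bounded size, and let $\mathfrak X_c=\{\mu\}$. Then datasets of i.i.d. records from $\mu$ are distribution learnable for the rank operation with accuracy constants $\varkappa_1,\varkappa_2$ and $\mathcal T_n=\mathcal S_n=n\mathcal B_n=1$, the constant in $O(\cdot)$ depending on $\mu$ only. -/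

import Mathlib

open MeasureTheory Set
open scoped ENNReal

noncomputable section

/-! The machine: a word RAM with additional real registers (a real RAM).  A program works on
natural-number registers, real registers, a random-access memory of natural numbers, and a
read-only random-access array of `n` reals (the dataset).  Every instruction costs one operation.
A natural number written to a register may not exceed the word bound `W`. -/

/-- Instructions.  `d` is the index of the destination register, `a` and `b` are indices of
argument registers, `t` is the target of a jump. -/
inductive Instr where
  /-- natural constant -/
  | natConst (d c : ℕ)
  | natAdd (d a b : ℕ)
  /-- truncated subtraction -/
  | natSub (d a b : ℕ)
  | natMul (d a b : ℕ)
  /-- quotient with remainder dropped; division by zero is an error -/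
  | natDiv (d a b : ℕ)
  /-- read the memory cell whose address is in natural register `a` -/
  | natLoad (d a : ℕ)
  /-- write natural register `b` to the memory cell whose address is in natural register `a` -/
  | natStore (a b : ℕ)
  /-- the number of records of the dataset -/
  | size (d : ℕ)
  /-- real constant -/
  | realConst (d : ℕ) (c : ℝ)
  | realAdd (d a b : ℕ)
  | realSub (d a b : ℕ)
  | realMul (d a b : ℕ)
  /-- division by zero is an error -/
  | realDiv (d a b : ℕ)
  /-- convert natural register `a` to a real -/
  | realOfNat (d a : ℕ)
  /-- round the nonnegative real register `a` down to a natural number -/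
  | realFloor (d a : ℕ)
  /-- read the record of the dataset whose (zero-based) index is in natural register `a` -/
  | realData (d a : ℕ)
  | jump (t : ℕ)
  /-- jump if natural register `a` is smaller than natural register `b` -/
  | jumpNatLt (a b t : ℕ)
  /-- jump if real register `a` is smaller than real register `b` -/
  | jumpRealLt (a b t : ℕ)
  | halt

abbrev Program := List Instr

/-- A configuration: program counter, natural registers, real registers, memory. -/
structure Config where
  pc : ℕ
  nat : ℕ → ℕ
  real : ℕ → ℝ
  mem : ℕ → ℕ

/-- Write `v` to natural register `d` and move on; an error if `v` does not fit into a word. -/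
def Config.setNat (W : ℕ) (s : Config) (d v : ℕ) : Option Config :=
  if v ≤ W then some { s with pc := s.pc + 1, nat := Function.update s.nat d v } else none

/-- Write `v` to real register `d` and move on. -/
def Config.setReal (s : Config) (d : ℕ) (v : ℝ) : Option Config :=
  some { s with pc := s.pc + 1, real := Function.update s.real d v }

/-- The effect of one instruction; `none` stands for halting or an error. -/
def Instr.exec (W : ℕ) {n : ℕ} (data : Fin n → ℝ) (s : Config) : Instr → Option Config
  | natConst d c => s.setNat W d c
  | natAdd d a b => s.setNat W d (s.nat a + s.nat b)
  | natSub d a b => s.setNat W d (s.nat a - s.nat b)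
  | natMul d a b => s.setNat W d (s.nat a * s.nat b)
  | natDiv d a b => if s.nat b = 0 then none else s.setNat W d (s.nat a / s.nat b)
  | natLoad d a => s.setNat W d (s.mem (s.nat a))
  | natStore a b =>
      some { s with pc := s.pc + 1, mem := Function.update s.mem (s.nat a) (s.nat b) }
  | size d => s.setNat W d n
  | realConst d c => s.setReal d c
  | realAdd d a b => s.setReal d (s.real a + s.real b)
  | realSub d a b => s.setReal d (s.real a - s.real b)
  | realMul d a b => s.setReal d (s.real a * s.real b)
  | realDiv d a b => if s.real b = 0 then none else s.setReal d (s.real a / s.real b)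
  | realOfNat d a => s.setReal d (s.nat a)
  | realFloor d a => if s.real a < 0 then none else s.setNat W d ⌊s.real a⌋₊
  | realData d a => if h : s.nat a < n then s.setReal d (data ⟨s.nat a, h⟩) else none
  | jump t => some { s with pc := t }
  | jumpNatLt a b t => some { s with pc := if s.nat a < s.nat b then t else s.pc + 1 }
  | jumpRealLt a b t => some { s with pc := if s.real a < s.real b then t else s.pc + 1 }
  | halt => none

def Program.step (P : Program) (W : ℕ) {n : ℕ} (data : Fin n → ℝ) (s : Config) : Option Config :=
  P[s.pc]?.bind (Instr.exec W data s)

/-- Started in `s`, the program performs exactly `k` operations and is then in configuration `s'`,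
at a `halt` instruction. -/
def Program.HaltsIn (P : Program) (W : ℕ) {n : ℕ} (data : Fin n → ℝ) (s : Config) (k : ℕ)
    (s' : Config) : Prop :=
  (fun o : Option Config => o.bind (P.step W data))^[k] (some s) = some s' ∧
    P[s'.pc]? = some Instr.halt

/-- The training program `A`, started with all registers and all memory cells equal to zero, halts
after `k` operations and returns the list `model` of words: the first `L` memory cells, `L` being
the final content of natural register `0`. -/
def Trains (A : Program) (W : ℕ) {n : ℕ} (data : Fin n → ℝ) (model : List ℕ) (k : ℕ) : Prop :=
  ∃ s' : Config, A.HaltsIn W data ⟨0, fun _ => 0, fun _ => 0, fun _ => 0⟩ k s' ∧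
    model = (List.range (s'.nat 0)).map s'.mem

/-- The evaluation program `E`, started with the words of `model` in memory and the query `x` in
real register `0` (everything else zero), halts after `k` operations with `y` in real
register `0`. -/
def Evaluates (E : Program) (W : ℕ) {n : ℕ} (data : Fin n → ℝ) (model : List ℕ) (x : ℝ) (k : ℕ)
    (y : ℝ) : Prop :=
  ∃ s' : Config, E.HaltsIn W data
      ⟨0, fun _ => 0, Function.update (fun _ => 0) 0 x, fun i => model.getD i 0⟩ k s' ∧
    s'.real 0 = y

/-- The number of bits of a list of words (a word with value `0` takes one bit). -/
def bitSize (model : List ℕ) : ℕ := (model.map fun w => Nat.log 2 w + 1).sum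

/-! Rank operation and distribution learnability. -/

/-- The rank function of a dataset: the number of records smaller than `x`. -/
def rankFun {n : ℕ} (D : Fin n → ℝ) (x : ℝ) : ℝ := ((Finset.univ.filter fun i => D i < x).card : ℝ)

/-- The distribution rank function: the expectation of the rank function of a dataset whose `i`-th
record is sampled, independently of the others, from `χ i`. -/
def distRankFun {n : ℕ} (χ : Fin n → Measure ℝ) (x : ℝ) : ℝ :=
  ∫ D, rankFun D x ∂(Measure.pi χ)

/-- Distribution learnability for the rank operation, with accuracy constants `κ₁`, `κ₂`, inference
time `T n`, model space `S n` (in bits) and amortized training time `B n`, up to the constant `C`.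
The set `𝔖 n` consists of the families `(χ₁, …, χₙ)` from which a dataset of size `n` may be
sampled.  There are one training program `A` and one evaluation program `E`, for all `n`; `fhat n v`
is the model they produce from the sorted dataset `v`.  The dataset is available, as a sorted array,
in training and in evaluation and is not counted in the space of the model; the evaluation program
is counted.  Words have at most `C * log₂ (n + S n)` bits. -/
def RankLearnable (κ₁ κ₂ : ℝ) (C : ℕ) (𝔖 : ∀ n : ℕ, Set (Fin n → Measure ℝ))
    (T S B : ℕ → ℝ) : Prop :=
  ∃ (A E : Program) (fhat : ∀ n : ℕ, (Fin n → ℝ) → ℝ → ℝ),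
    (∀ n : ℕ, 1 ≤ n → ∀ v : Fin n → ℝ, Monotone v → (∀ i, v i ∈ Icc (0 : ℝ) 1) →
      ∃ (model : List ℕ) (k : ℕ),
        Trains A ⌊((n : ℝ) + S n) ^ C⌋₊ v model k ∧
        (k : ℝ) ≤ C * (n * B n) ∧
        ((E.length : ℝ) + (bitSize model : ℝ)) ≤ C * S n ∧
        ∀ x ∈ Icc (0 : ℝ) 1, ∃ j : ℕ,
          Evaluates E ⌊((n : ℝ) + S n) ^ C⌋₊ v model x j (fhat n v x) ∧ (j : ℝ) ≤ C * T n) ∧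
    (∀ n : ℕ, 1 ≤ n → ∀ χ ∈ 𝔖 n, ∀ ε : ℝ, √(n : ℝ) ≤ ε →
      Measure.pi χ {D : Fin n → ℝ | ENNReal.ofReal ε ≤
          ⨆ x ∈ Icc (0 : ℝ) 1, ENNReal.ofReal |distRankFun χ x - fhat n (D ∘ Tuple.sort D) x|}
        ≤ ENNReal.ofReal (κ₁ * Real.exp (-κ₂ * (ε / √(n : ℝ) - 1) ^ 2)))

/-! Distribution classes. -/

/-- A probability distribution of records in `[0, 1]`. -/
def IsDataDistribution (μ : Measure ℝ) : Prop :=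
  IsProbabilityMeasure μ ∧ μ (Icc (0 : ℝ) 1)ᶜ = 0

/-- The distribution function `x ↦ P (X < x)`, that is, the distribution rank function for a single
record; it agrees with `P (X ≤ x)` except at atoms. -/
def distFun (μ : Measure ℝ) (x : ℝ) : ℝ := (μ (Iio x)).toReal

/-- The distributions on `[0, 1]` with a probability density function bounded by `ρ`. -/
def BoundedDensity (ρ : ℝ) : Set (Measure ℝ) :=
  {μ | IsDataDistribution μ ∧ ∃ g : ℝ → ℝ≥0∞, Measurable g ∧ (∀ x, g x ≤ ENNReal.ofReal ρ) ∧
    μ = (volume : Measure ℝ).withDensity g}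

/-- The distributions on `[0, 1]` with a piecewise linear distribution function with at most `l`
pieces (jumps between pieces are allowed). -/
def PiecewiseLinearCDF (l : ℕ) : Set (Measure ℝ) :=
  {μ | IsDataDistribution μ ∧ ∃ t : ℕ → ℝ, Monotone t ∧ t 0 = 0 ∧ t l = 1 ∧
    ∀ i < l, ∃ a b : ℝ, ∀ x ∈ Ioo (t i) (t (i + 1)), distFun μ x = a * x + b}

/-- The distribution function is computed on `[0, 1]` by a program, without a dataset, in a bounded
number of operations on words of bounded size. -/
def ConstantTimeCDF (μ : Measure ℝ) : Prop :=
  IsDataDistribution μ ∧ ∃ (P : Program) (W k : ℕ), ∀ x ∈ Icc (0 : ℝ) 1, ∃ j ≤ k,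
    Evaluates P W (Fin.elim0 : Fin 0 → ℝ) [] x j (distFun μ x)

/-- The average `(χ₁ + ⋯ + χₙ) / n`. -/
def averageDist {n : ℕ} (χ : Fin n → Measure ℝ) : Measure ℝ := (n : ℝ≥0∞)⁻¹ • ∑ i, χ i

/-- The families all members of which belong to the class `𝔛`. -/
def familiesIn (𝔛 : Set (Measure ℝ)) (n : ℕ) : Set (Fin n → Measure ℝ) := {χ | ∀ i, χ i ∈ 𝔛}

/-- The families all members of which, and their average as well, belong to the class `𝔛`.  Constant
families (identically distributed records) with values in `𝔛` are among them. -/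
def averagedFamiliesIn (𝔛 : Set (Measure ℝ)) (n : ℕ) : Set (Fin n → Measure ℝ) :=
  {χ | (∀ i, χ i ∈ 𝔛) ∧ averageDist χ ∈ 𝔛}

end

/-! The proof has a probabilistic half, common to the three classes, and a deterministic half about
programs. The probabilistic half is an inequality of Dvoretzky–Kiefer–Wolfowitz type for independent
records with possibly different distributions, `pi_exists_lt_abs_rankFun_sub`: for `δ ≥ √n` the rank
function deviates somewhere from its mean by more than `δ` with probability at most `8 exp (-(δ -
√n)² / (8 n))`. A ghost sample replaces the mean, exchanging the two copies of single records
creates random signs, and a maximal inequality for partial sums of signs takes the place of a union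
bound over the ranks, which would cost a factor depending on `n`.

By `rankLearnable_of_forall_dataset` it remains to treat a fixed sorted dataset whose rank function
is within `δ` of the distribution rank function `r`, and to return a value within `5 δ + 4 √n` of `r
x` in the permitted time and space.

For densities bounded by `ρ`, `r` is Lipschitz with constant `ρ n`, so on a grid of mesh at most `1
/ (ρ √n)` it changes by at most `√n` from one point to the next. The ranks of grid points are needed
only up to `⌈√n⌉`; merging the grid with every `⌈√n⌉`-th record finds them.

For piecewise linear `r`, the pairs (record, index) are close to the graph of a function with `l`
affine pieces. A greedy chord with tolerance `τ ≥ 2 δ` can fail to be extended only at a breakpoint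
of `r`, so `4 l + 8` failures force `τ < 2 δ` (`lt_two_mul_of_links`). As `δ` is unknown to the
program, `τ` starts at `⌈√n⌉` and is doubled after that many failures; the final `τ` is `⌈√n⌉` or
less than `4 δ`. Testing only multiples of `⌈√n⌉` keeps the quadratic greedy search linear in `n`
for each tolerance. The model stores indices only, and a query is a binary search among `O(l)` of
them.

For a single computable distribution the exact value `n F(x)` is returned and nothing is trained. -/

/-! ### Running programs -/

/-- Started in `s`, the program halts after at most `k` operations in a configuration with `Q`. -/
def Program.HaltsWithin (P : Program) (W : ℕ) {n : ℕ} (data : Fin n → ℝ) (s : Config) (k : ℕ)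
    (Q : Config → Prop) : Prop :=
  ∃ j ≤ k, ∃ s', P.HaltsIn W data s j s' ∧ Q s'

/-- The register file with contents `l`, padded with zeros. -/
def regs {α : Type*} [Zero α] (l : List α) : ℕ → α := fun i => l.getD i 0

/-- Registers are kept as explicit lists during symbolic execution; the bound is a Boolean equation
so that `rfl` proves it for concrete indices. -/
theorem update_regs {α : Type*} [Zero α] {l : List α} {d : ℕ} (hd : Nat.blt d l.length = true)
    (v : α) : Function.update (regs l) d v = regs (l.set d v) := by
  have hd' : d < l.length := by simpa [Nat.blt_eq] using hd
  funext i
  rcases eq_or_ne i d with rfl | h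
  · simp [regs, List.getD_eq_getElem?_getD, hd']
  · simp [regs, List.getD_eq_getElem?_getD, h, List.getElem?_set_ne h.symm]

theorem regs_zero {α : Type*} [Zero α] (k : ℕ) :
    (fun _ => 0 : ℕ → α) = regs (List.replicate k 0) := by
  funext i
  simp only [regs, List.getD_eq_getElem?_getD, List.getElem?_replicate]
  split_ifs <;> rfl

theorem regs_cons {α : Type*} [Zero α] (x : α) (k : ℕ) :
    Function.update (fun _ => 0 : ℕ → α) 0 x = regs (x :: List.replicate k 0) := by
  rw [regs_zero (k + 1), update_regs (by simp [Nat.blt_eq])]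
  rfl

namespace Program.HaltsWithin

variable {P : Program} {W n : ℕ} {data : Fin n → ℝ} {Q : Config → Prop} {k pc d a b t : ℕ}
  {l : List ℕ} {r : List ℝ} {mem : ℕ → ℕ}

theorem mono {s : Config} {k k' : ℕ} (h : P.HaltsWithin W data s k Q) (hk : k ≤ k') :
    P.HaltsWithin W data s k' Q := by
  obtain ⟨j, hj, h⟩ := h
  exact ⟨j, hj.trans hk, h⟩

/-- The execution rules are in continuation form: an instruction spends one unit of the budget, and
the rest of the run is a hypothesis. -/
theorem step {s s₁ : Config} (h : P.step W data s = some s₁)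
    (H : P.HaltsWithin W data s₁ k Q) : P.HaltsWithin W data s (k + 1) Q := by
  obtain ⟨j, hj, s', ⟨hr, hh⟩, hQ⟩ := H
  refine ⟨j + 1, by omega, s', ⟨?_, hh⟩, hQ⟩
  rw [Function.iterate_succ_apply]
  simpa [h] using hr

theorem exec {i : Instr} {s s₁ : Config} (hi : P[s.pc]? = some i)
    (he : i.exec W data s = some s₁) (H : P.HaltsWithin W data s₁ k Q) :
    P.HaltsWithin W data s (k + 1) Q :=
  step (by simp [Program.step, hi, he]) H

theorem halt {s : Config} (hi : P[s.pc]? = some .halt) (hQ : Q s) :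
    P.HaltsWithin W data s k Q :=
  ⟨0, Nat.zero_le _, s, ⟨rfl, hi⟩, hQ⟩

theorem setNat {i : Instr} {v : ℕ} (hi : P[pc]? = some i)
    (he : i.exec W data ⟨pc, regs l, regs r, mem⟩ =
      Config.setNat W ⟨pc, regs l, regs r, mem⟩ d v)
    (hd : Nat.blt d l.length = true) (hv : v ≤ W)
    (H : P.HaltsWithin W data ⟨pc + 1, regs (l.set d v), regs r, mem⟩ k Q) :
    P.HaltsWithin W data ⟨pc, regs l, regs r, mem⟩ (k + 1) Q :=
  exec hi (by rw [he, Config.setNat, if_pos hv, ← update_regs hd]) H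

theorem setReal {i : Instr} {v : ℝ} (hi : P[pc]? = some i)
    (he : i.exec W data ⟨pc, regs l, regs r, mem⟩ =
      Config.setReal ⟨pc, regs l, regs r, mem⟩ d v)
    (hd : Nat.blt d r.length = true)
    (H : P.HaltsWithin W data ⟨pc + 1, regs l, regs (r.set d v), mem⟩ k Q) :
    P.HaltsWithin W data ⟨pc, regs l, regs r, mem⟩ (k + 1) Q :=
  exec hi (by rw [he, Config.setReal, ← update_regs hd]) H

theorem natConst {c : ℕ} (hi : P[pc]? = some (.natConst d c)) (hd : Nat.blt d l.length = true)
    (hv : c ≤ W) (H : P.HaltsWithin W data ⟨pc + 1, regs (l.set d c), regs r, mem⟩ k Q) :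
    P.HaltsWithin W data ⟨pc, regs l, regs r, mem⟩ (k + 1) Q :=
  setNat hi rfl hd hv H

theorem natAdd (hi : P[pc]? = some (.natAdd d a b)) (hd : Nat.blt d l.length = true)
    (hv : regs l a + regs l b ≤ W)
    (H : P.HaltsWithin W data ⟨pc + 1, regs (l.set d (regs l a + regs l b)), regs r, mem⟩ k Q) :
    P.HaltsWithin W data ⟨pc, regs l, regs r, mem⟩ (k + 1) Q :=
  setNat hi rfl hd hv H

theorem natSub (hi : P[pc]? = some (.natSub d a b)) (hd : Nat.blt d l.length = true)
    (hv : regs l a - regs l b ≤ W)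
    (H : P.HaltsWithin W data ⟨pc + 1, regs (l.set d (regs l a - regs l b)), regs r, mem⟩ k Q) :
    P.HaltsWithin W data ⟨pc, regs l, regs r, mem⟩ (k + 1) Q :=
  setNat hi rfl hd hv H

theorem natMul (hi : P[pc]? = some (.natMul d a b)) (hd : Nat.blt d l.length = true)
    (hv : regs l a * regs l b ≤ W)
    (H : P.HaltsWithin W data ⟨pc + 1, regs (l.set d (regs l a * regs l b)), regs r, mem⟩ k Q) :
    P.HaltsWithin W data ⟨pc, regs l, regs r, mem⟩ (k + 1) Q :=
  setNat hi rfl hd hv H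

theorem natDiv (hi : P[pc]? = some (.natDiv d a b)) (hd : Nat.blt d l.length = true)
    (h0 : regs l b ≠ 0) (hv : regs l a / regs l b ≤ W)
    (H : P.HaltsWithin W data ⟨pc + 1, regs (l.set d (regs l a / regs l b)), regs r, mem⟩ k Q) :
    P.HaltsWithin W data ⟨pc, regs l, regs r, mem⟩ (k + 1) Q :=
  setNat hi (if_neg h0) hd hv H

theorem natLoad (hi : P[pc]? = some (.natLoad d a)) (hd : Nat.blt d l.length = true)
    (hv : mem (regs l a) ≤ W)
    (H : P.HaltsWithin W data ⟨pc + 1, regs (l.set d (mem (regs l a))), regs r, mem⟩ k Q) :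
    P.HaltsWithin W data ⟨pc, regs l, regs r, mem⟩ (k + 1) Q :=
  setNat hi rfl hd hv H

theorem natStore (hi : P[pc]? = some (.natStore a b))
    (H : P.HaltsWithin W data
      ⟨pc + 1, regs l, regs r, Function.update mem (regs l a) (regs l b)⟩ k Q) :
    P.HaltsWithin W data ⟨pc, regs l, regs r, mem⟩ (k + 1) Q :=
  exec hi rfl H

theorem size (hi : P[pc]? = some (.size d)) (hd : Nat.blt d l.length = true)
    (hv : n ≤ W) (H : P.HaltsWithin W data ⟨pc + 1, regs (l.set d n), regs r, mem⟩ k Q) :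
    P.HaltsWithin W data ⟨pc, regs l, regs r, mem⟩ (k + 1) Q :=
  setNat hi rfl hd hv H

theorem realConst {c : ℝ} (hi : P[pc]? = some (.realConst d c)) (hd : Nat.blt d r.length = true)
    (H : P.HaltsWithin W data ⟨pc + 1, regs l, regs (r.set d c), mem⟩ k Q) :
    P.HaltsWithin W data ⟨pc, regs l, regs r, mem⟩ (k + 1) Q :=
  setReal hi rfl hd H

theorem realAdd (hi : P[pc]? = some (.realAdd d a b)) (hd : Nat.blt d r.length = true)
    (H : P.HaltsWithin W data ⟨pc + 1, regs l, regs (r.set d (regs r a + regs r b)), mem⟩ k Q) :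
    P.HaltsWithin W data ⟨pc, regs l, regs r, mem⟩ (k + 1) Q :=
  setReal hi rfl hd H

theorem realSub (hi : P[pc]? = some (.realSub d a b)) (hd : Nat.blt d r.length = true)
    (H : P.HaltsWithin W data ⟨pc + 1, regs l, regs (r.set d (regs r a - regs r b)), mem⟩ k Q) :
    P.HaltsWithin W data ⟨pc, regs l, regs r, mem⟩ (k + 1) Q :=
  setReal hi rfl hd H

theorem realMul (hi : P[pc]? = some (.realMul d a b)) (hd : Nat.blt d r.length = true)
    (H : P.HaltsWithin W data ⟨pc + 1, regs l, regs (r.set d (regs r a * regs r b)), mem⟩ k Q) :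
    P.HaltsWithin W data ⟨pc, regs l, regs r, mem⟩ (k + 1) Q :=
  setReal hi rfl hd H

theorem realDiv (hi : P[pc]? = some (.realDiv d a b)) (hd : Nat.blt d r.length = true)
    (h0 : regs r b ≠ 0)
    (H : P.HaltsWithin W data ⟨pc + 1, regs l, regs (r.set d (regs r a / regs r b)), mem⟩ k Q) :
    P.HaltsWithin W data ⟨pc, regs l, regs r, mem⟩ (k + 1) Q :=
  setReal hi (if_neg h0) hd H

theorem realOfNat (hi : P[pc]? = some (.realOfNat d a)) (hd : Nat.blt d r.length = true)
    (H : P.HaltsWithin W data ⟨pc + 1, regs l, regs (r.set d ((regs l a : ℕ) : ℝ)), mem⟩ k Q) :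
    P.HaltsWithin W data ⟨pc, regs l, regs r, mem⟩ (k + 1) Q :=
  setReal hi rfl hd H

theorem realFloor (hi : P[pc]? = some (.realFloor d a)) (hd : Nat.blt d l.length = true)
    (h0 : 0 ≤ regs r a) (hv : ⌊regs r a⌋₊ ≤ W)
    (H : P.HaltsWithin W data ⟨pc + 1, regs (l.set d ⌊regs r a⌋₊), regs r, mem⟩ k Q) :
    P.HaltsWithin W data ⟨pc, regs l, regs r, mem⟩ (k + 1) Q :=
  setNat hi (if_neg h0.not_gt) hd hv H

theorem realData (hi : P[pc]? = some (.realData d a)) (hd : Nat.blt d r.length = true)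
    (hn : regs l a < n)
    (H : P.HaltsWithin W data ⟨pc + 1, regs l, regs (r.set d (data ⟨regs l a, hn⟩)), mem⟩ k Q) :
    P.HaltsWithin W data ⟨pc, regs l, regs r, mem⟩ (k + 1) Q :=
  setReal hi (dif_pos hn) hd H

theorem jump (hi : P[pc]? = some (.jump t))
    (H : P.HaltsWithin W data ⟨t, regs l, regs r, mem⟩ k Q) :
    P.HaltsWithin W data ⟨pc, regs l, regs r, mem⟩ (k + 1) Q :=
  exec hi rfl H

theorem jumpNatLt_pos (hi : P[pc]? = some (.jumpNatLt a b t)) (h : regs l a < regs l b)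
    (H : P.HaltsWithin W data ⟨t, regs l, regs r, mem⟩ k Q) :
    P.HaltsWithin W data ⟨pc, regs l, regs r, mem⟩ (k + 1) Q :=
  exec hi (by simp [Instr.exec, h]) H

theorem jumpNatLt_neg (hi : P[pc]? = some (.jumpNatLt a b t)) (h : ¬ regs l a < regs l b)
    (H : P.HaltsWithin W data ⟨pc + 1, regs l, regs r, mem⟩ k Q) :
    P.HaltsWithin W data ⟨pc, regs l, regs r, mem⟩ (k + 1) Q :=
  exec hi (by simp only [Instr.exec, h, if_false]) H

theorem jumpRealLt_pos (hi : P[pc]? = some (.jumpRealLt a b t)) (h : regs r a < regs r b)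
    (H : P.HaltsWithin W data ⟨t, regs l, regs r, mem⟩ k Q) :
    P.HaltsWithin W data ⟨pc, regs l, regs r, mem⟩ (k + 1) Q :=
  exec hi (by simp [Instr.exec, h]) H

theorem jumpRealLt_neg (hi : P[pc]? = some (.jumpRealLt a b t)) (h : ¬ regs r a < regs r b)
    (H : P.HaltsWithin W data ⟨pc + 1, regs l, regs r, mem⟩ k Q) :
    P.HaltsWithin W data ⟨pc, regs l, regs r, mem⟩ (k + 1) Q :=
  exec hi (by simp only [Instr.exec, h, if_false]) H

end Program.HaltsWithin

/-! ### Scaling the output of a program by the size of the dataset -/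

/-- The instruction adapted to a machine with a dataset: the size of the (empty) dataset is
replaced by a constant, and instead of halting the program jumps to `t`. -/
def Instr.withoutData (t : ℕ) : Instr → Instr
  | .size d => .natConst d 0
  | .halt => .jump t
  | i => i

/-- Run `P` as if there were no dataset and multiply the result by the number of records. -/
def Program.timesSize (P : Program) : Program :=
  P.map (Instr.withoutData P.length) ++ [.size 0, .realOfNat 1 0, .realMul 0 0 1, .halt]

theorem Config.setNat_mono {W W' : ℕ} (hW : W ≤ W') {s s' : Config} {d v : ℕ}
    (h : s.setNat W d v = some s') : s.setNat W' d v = some s' := by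
  unfold Config.setNat at h ⊢
  split_ifs at h with h1
  rw [if_pos (h1.trans hW)]
  exact h

/-- An instruction that succeeds on an empty dataset reads no record, and a larger word bound cannot
make it fail. -/
theorem Instr.exec_withoutData {W W' n t : ℕ} (hW : W ≤ W') (data : Fin n → ℝ) {s s' : Config}
    (i : Instr) (h : i.exec W (Fin.elim0 : Fin 0 → ℝ) s = some s') :
    (i.withoutData t).exec W' data s = some s' := by
  cases i with
  | realData d a => simp [Instr.exec] at h
  | halt => simp [Instr.exec] at h
  | natDiv d a b =>
    simp only [Instr.exec] at h
    split_ifs at h with h1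
    simpa only [Instr.withoutData, Instr.exec, h1, if_false] using Config.setNat_mono hW h
  | realFloor d a =>
    simp only [Instr.exec] at h
    split_ifs at h with h1
    simpa only [Instr.withoutData, Instr.exec, h1, if_false] using Config.setNat_mono hW h
  | natConst | natAdd | natSub | natMul | natLoad | size => exact Config.setNat_mono hW h
  | natStore | realConst | realAdd | realSub | realMul | realDiv | realOfNat | jump | jumpNatLt
  | jumpRealLt => exact h

/-- The run of `P` is simulated step by step. The four additional operations are the jump that
replaces `halt` and the three instructions of the tail. -/
theorem Program.timesSize_halts {P : Program} {W W' n : ℕ} (hW : W ≤ W') (hn : n ≤ W')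
    (data : Fin n → ℝ) {k : ℕ} {s s' : Config}
    (h : P.HaltsIn W (Fin.elim0 : Fin 0 → ℝ) s k s') :
    P.timesSize.HaltsWithin W' data s (k + 4) fun c => c.real 0 = s'.real 0 * n := by
  induction k generalizing s with
  | zero =>
    obtain ⟨h1, h2⟩ := h
    simp only [Function.iterate_zero, id_eq, Option.some.injEq] at h1
    subst h1
    have hpc : s.pc < P.length := by
      by_contra hc
      rw [List.getElem?_eq_none (not_lt.1 hc)] at h2
      cases h2
    have hjump : P.timesSize[s.pc]? = some (.jump P.length) := by
      rw [Program.timesSize, List.getElem?_append_left (by simpa using hpc), List.getElem?_map, h2]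
      rfl
    have hend (i : ℕ) : P.timesSize[P.length + i]? =
        ([.size 0, .realOfNat 1 0, .realMul 0 0 1, .halt] : Program)[i]? := by
      rw [Program.timesSize, List.getElem?_append_right (by simp)]
      simp
    refine .exec hjump rfl ?_
    refine .exec (hend 0) (s₁ := ⟨P.length + 1, Function.update s.nat 0 n, s.real, s.mem⟩) ?_ ?_
    · simp [Instr.exec, Config.setNat, hn]
    refine .exec (hend 1) rfl ?_
    refine .exec (hend 2) rfl ?_
    exact .halt (hend 3) (by simp)
  | succ k ih =>
    obtain ⟨h1, h2⟩ := h
    rw [Function.iterate_succ_apply] at h1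
    simp only [Option.bind_some] at h1
    cases hs : P.step W (Fin.elim0 : Fin 0 → ℝ) s with
    | none =>
      rw [hs] at h1
      have hnone : ∀ j : ℕ, (fun o : Option Config =>
          o.bind (P.step W (Fin.elim0 : Fin 0 → ℝ)))^[j] none = none := fun j =>
        Function.iterate_fixed rfl j
      rw [hnone] at h1
      cases h1
    | some s₁ =>
      rw [hs] at h1
      have := ih ⟨h1, h2⟩
      rw [show k + 1 + 4 = (k + 4) + 1 by ring]
      simp only [Program.step, Option.bind_eq_some_iff] at hs
      obtain ⟨i, hi, hex⟩ := hs
      have hpc : s.pc < P.length := by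
        by_contra hc
        rw [List.getElem?_eq_none (not_lt.1 hc)] at hi
        cases hi
      refine .exec (i := i.withoutData P.length) ?_ (Instr.exec_withoutData hW data i hex) this
      rw [Program.timesSize, List.getElem?_append_left (by simpa using hpc), List.getElem?_map, hi]
      rfl

/-! ### A uniform deviation inequality for rank functions -/

theorem rankFun_eq_sum {n : ℕ} (D : Fin n → ℝ) (x : ℝ) :
    rankFun D x = ∑ i, if D i < x then (1 : ℝ) else 0 := by
  rw [rankFun, Finset.sum_boole]

theorem measurable_rankFun {n : ℕ} (x : ℝ) : Measurable fun D : Fin n → ℝ => rankFun D x := by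
  simp_rw [rankFun_eq_sum]
  exact Finset.measurable_sum _ fun i _ =>
    Measurable.ite (measurableSet_lt (measurable_pi_apply i) measurable_const)
      measurable_const measurable_const

open Classical in
/-- Random signs are summed in the order of the values `D i`; the exponential bound for the
probability that one of the partial sums reaches `t`. -/
theorem sum_powerset_exists_le_signed_sum {ι : Type*} [DecidableEq ι] (D : ι → ℝ) {lam η : ℝ} (hl : 0 ≤ lam)
    (hη : |η| = 1) (s : Finset ι) (t : ℝ) :
    ∑ T ∈ s.powerset, (if ∃ x, t ≤ ∑ i ∈ s, (if i ∈ T then η else -η) * (if D i < x then 1 else 0)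
      then (1 : ℝ) else 0) ≤ Real.exp (-(lam * t)) * (2 * Real.cosh lam) ^ s.card := by
  have hcosh : Real.exp (lam * η) + Real.exp (lam * -η) = 2 * Real.cosh lam := by
    rcases eq_or_eq_neg_of_abs_eq hη with rfl | rfl <;> rw [Real.cosh_eq] <;> ring_nf
  -- At a nonpositive level the bound exceeds the number of subsets. Partial sums that have already
  -- reached the level end up in this case, which plays the role of stopping.
  have htriv (s : Finset ι) (t : ℝ) (ht : t ≤ 0) (p : Finset ι → Prop) :
      ∑ T ∈ s.powerset, (if p T then (1 : ℝ) else 0) ≤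
        Real.exp (-(lam * t)) * (2 * Real.cosh lam) ^ s.card := by
    calc _ ≤ ∑ T ∈ s.powerset, (1 : ℝ) := by
          gcongr; split_ifs <;> norm_num
      _ = 1 * (2 * 1) ^ s.card := by simp [Finset.card_powerset]
      _ ≤ _ := by
          gcongr
          · exact Real.one_le_exp (by nlinarith)
          · exact Real.one_le_cosh lam
  induction s using Finset.induction_on_min_value D generalizing t with
  | empty =>
    rcases le_or_gt t 0 with ht | ht
    · exact htriv _ t ht _
    · simp only [Finset.sum_empty, not_le.2 ht, exists_const, if_false, Finset.sum_const_zero]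
      positivity
  | insert a s ha hmin ih =>
    rcases le_or_gt t 0 with ht | ht
    · exact htriv _ t ht _
    -- The record with the smallest value enters every nonempty partial sum. As `t > 0`, the level
    -- can be reached only with its sign `σ` included, so the remaining records have to reach `t -
    -- σ`.
    have key (T : Finset ι) (σ : ℝ) (hσ : σ = if a ∈ T then η else -η) (T' : Finset ι)
        (hT' : ∀ i ∈ s, i ∈ T ↔ i ∈ T') :
        (if ∃ x, t ≤ ∑ i ∈ insert a s, (if i ∈ T then η else -η) * (if D i < x then 1 else 0)
          then (1 : ℝ) else 0) ≤
        if ∃ x, t - σ ≤ ∑ i ∈ s, (if i ∈ T' then η else -η) * (if D i < x then 1 else 0)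
          then (1 : ℝ) else 0 := by
      split_ifs with h1 h2 <;> try norm_num
      obtain ⟨x, hx⟩ := h1
      refine h2 ⟨x, ?_⟩
      rw [Finset.sum_insert ha, ← hσ] at hx
      rcases lt_or_ge (D a) x with hax | hax
      · rw [if_pos hax] at hx
        have : ∀ i ∈ s, (if i ∈ T then η else -η) * (if D i < x then (1 : ℝ) else 0) =
            (if i ∈ T' then η else -η) * (if D i < x then 1 else 0) := by
          intro i hi
          simp only [hT' i hi]
        rw [Finset.sum_congr rfl this] at hx
        linarith
      · rw [if_neg hax.not_gt, Finset.sum_eq_zero] at hx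
        · linarith
        · intro i hi
          rw [if_neg (hax.trans (hmin i hi)).not_gt, mul_zero]
    rw [Finset.sum_powerset_insert ha, Finset.card_insert_of_notMem ha]
    have h1 := (Finset.sum_le_sum fun T hT => key T (-η)
      (by rw [if_neg fun h => ha (Finset.mem_powerset.1 hT h)]) T fun _ _ => Iff.rfl).trans
        (ih (t - -η))
    have h2 := (Finset.sum_le_sum fun T (_ : T ∈ s.powerset) => key (insert a T) η (by simp) T
      fun i hi => by simp [(show i ≠ a from fun h => ha (h ▸ hi))]).trans (ih (t - η))
    refine (add_le_add h1 h2).trans (le_of_eq ?_)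
    rw [pow_succ, ← hcosh, show -(lam * (t - -η)) = -(lam * t) + lam * -η by ring,
      show -(lam * (t - η)) = -(lam * t) + lam * η by ring, Real.exp_add, Real.exp_add]
    ring

-- If the difference of two signed rank sums exceeds `u` in absolute value, then one of the two
-- sums, with one of the two signs, reaches `u / 2`; this gives the factor `4`.
open Classical in
theorem sum_powerset_exists_lt_abs_sum {n : ℕ} (hn : 0 < n) (Z : Fin n → ℝ × ℝ) {u : ℝ}
    (hu : 0 ≤ u) :
    ∑ T : Finset (Fin n), (if ∃ q : ℚ, u < |∑ i, (if i ∈ T then 1 else -1) *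
      ((if (Z i).1 < q then 1 else 0) - (if (Z i).2 < q then (1 : ℝ) else 0))|
      then (1 : ℝ) else 0) ≤ 2 ^ n * (4 * Real.exp (-(u ^ 2 / (8 * n)))) := by
  have hn' : (0 : ℝ) < n := by exact_mod_cast hn
  set f : (Fin n → ℝ) → ℝ → Finset (Fin n) → ℝ := fun D η T =>
    if ∃ x, u / 2 ≤ ∑ i, (if i ∈ T then η else -η) * (if D i < x then 1 else 0) then (1 : ℝ) else 0
    with hf
  have hbound (D : Fin n → ℝ) (η : ℝ) (hη : |η| = 1) :
      ∑ T : Finset (Fin n), f D η T ≤ 2 ^ n * Real.exp (-(u ^ 2 / (8 * n))) := by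
    -- This `lam` minimizes the exponent `n lam² / 2 - lam u / 2`, with minimum `-u² / (8 n)`.
    have h := sum_powerset_exists_le_signed_sum D (lam := u / (2 * n)) (by positivity) hη
      Finset.univ (u / 2)
    rw [Finset.powerset_univ, Finset.card_univ, Fintype.card_fin] at h
    refine h.trans ?_
    rw [mul_pow, mul_left_comm]
    gcongr
    calc _ ≤ Real.exp (-(u / (2 * n) * (u / 2))) * Real.exp ((u / (2 * n)) ^ 2 / 2) ^ n := by
          gcongr
          exact Real.cosh_le_exp_half_sq _
      _ = _ := by
          rw [← Real.exp_nat_mul, ← Real.exp_add]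
          congr 1
          field_simp
          ring
  have hf0 (D η T) : 0 ≤ f D η T := by
    simp only [hf]; split_ifs <;> norm_num
  have hf1 (D η T) (h : ∃ x, u / 2 ≤ ∑ i, (if i ∈ T then η else -η) * (if D i < x then 1 else 0)) :
      f D η T = 1 := by simp only [hf]; rw [if_pos h]
  calc _ ≤ ∑ T : Finset (Fin n), (f (fun i => (Z i).1) 1 T + f (fun i => (Z i).1) (-1) T +
        f (fun i => (Z i).2) 1 T + f (fun i => (Z i).2) (-1) T) := by
        refine Finset.sum_le_sum fun T _ => ?_
        split_ifs with h
        swap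
        · linarith [hf0 (fun i => (Z i).1) 1 T, hf0 (fun i => (Z i).1) (-1) T,
            hf0 (fun i => (Z i).2) 1 T, hf0 (fun i => (Z i).2) (-1) T]
        obtain ⟨q, hq⟩ := h
        simp_rw [mul_sub, Finset.sum_sub_distrib] at hq
        have hneg (D : Fin n → ℝ) : ∑ i, (if i ∈ T then (-1 : ℝ) else - -1) *
            (if D i < q then 1 else 0) =
            - ∑ i, (if i ∈ T then (1 : ℝ) else -1) * (if D i < q then 1 else 0) := by
          rw [← Finset.sum_neg_distrib]
          refine Finset.sum_congr rfl fun i _ => ?_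
          split_ifs <;> norm_num
        have h1 := hneg fun i => (Z i).1
        have h2 := hneg fun i => (Z i).2
        by_contra! hlt
        have e1 : f (fun i => (Z i).1) 1 T < 1 := by
          linarith [hf0 (fun i => (Z i).1) (-1) T,
            hf0 (fun i => (Z i).2) 1 T, hf0 (fun i => (Z i).2) (-1) T]
        have e2 : f (fun i => (Z i).1) (-1) T < 1 := by
          linarith [hf0 (fun i => (Z i).1) 1 T,
            hf0 (fun i => (Z i).2) 1 T, hf0 (fun i => (Z i).2) (-1) T]
        have e3 : f (fun i => (Z i).2) 1 T < 1 := by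
          linarith [hf0 (fun i => (Z i).1) 1 T, hf0 (fun i => (Z i).1) (-1) T,
            hf0 (fun i => (Z i).2) (-1) T]
        have e4 : f (fun i => (Z i).2) (-1) T < 1 := by
          linarith [hf0 (fun i => (Z i).1) 1 T, hf0 (fun i => (Z i).1) (-1) T,
            hf0 (fun i => (Z i).2) 1 T]
        have g1 := fun h => e1.ne (hf1 _ _ _ ⟨(q : ℝ), h⟩)
        have g2 := fun h => e2.ne (hf1 _ _ _ ⟨(q : ℝ), h⟩)
        have g3 := fun h => e3.ne (hf1 _ _ _ ⟨(q : ℝ), h⟩)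
        have g4 := fun h => e4.ne (hf1 _ _ _ ⟨(q : ℝ), h⟩)
        rw [h1] at g2
        rw [h2] at g4
        rw [imp_false, not_le] at g1 g2 g3 g4
        rcases lt_abs.1 hq with h | h <;> linarith
    _ ≤ _ := by
        simp_rw [Finset.sum_add_distrib]
        linarith [hbound (fun i => (Z i).1) 1 (by simp), hbound (fun i => (Z i).1) (-1) (by simp),
          hbound (fun i => (Z i).2) 1 (by simp), hbound (fun i => (Z i).2) (-1) (by simp)]

open Classical in
/-- Symmetrization: two independent samples of the same family have close rank functions. -/
theorem prod_exists_lt_abs_rankFun_sub {n : ℕ} (hn : 0 < n) (χ : Fin n → Measure ℝ)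
    [∀ i, IsProbabilityMeasure (χ i)] {u : ℝ} (hu : 0 ≤ u) :
    (Measure.pi χ).prod (Measure.pi χ)
      {p | ∃ q : ℚ, u < |rankFun p.1 q - rankFun p.2 q|} ≤
      ENNReal.ofReal (4 * Real.exp (-(u ^ 2 / (8 * n)))) := by
  set Ξ := Measure.pi fun i => (χ i).prod (χ i)
  set B : Finset (Fin n) → Set (Fin n → ℝ × ℝ) := fun T =>
    {Z | ∃ q : ℚ, u < |∑ i, (if i ∈ T then 1 else -1) *
      ((if (Z i).1 < q then 1 else 0) - (if (Z i).2 < q then (1 : ℝ) else 0))|} with hB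
  have hBm (T) : MeasurableSet (B T) := by
    simp only [hB, ofPred_exists]
    refine MeasurableSet.iUnion fun q => measurableSet_lt measurable_const ?_
    refine Measurable.abs (Finset.measurable_sum _ fun i _ => measurable_const.mul ?_)
    refine Measurable.sub ?_ ?_ <;>
    refine Measurable.ite (measurableSet_lt ?_ measurable_const) measurable_const measurable_const
    · exact measurable_fst.comp (measurable_pi_apply i)
    · exact measurable_snd.comp (measurable_pi_apply i)
  -- Exchanging the two copies of the records outside `T` preserves the product measure and flips
  -- exactly their signs. Hence all sign patterns are equally likely to be bad, and it suffices to
  -- average over them.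
  have hswap (T : Finset (Fin n)) : Ξ (B T) = Ξ (B Finset.univ) := by
    have hp : MeasurePreserving (fun (Z : Fin n → ℝ × ℝ) i =>
        (if i ∈ T then id else Prod.swap) (Z i)) Ξ Ξ := by
      refine measurePreserving_pi _ _ (f := fun i => if i ∈ T then id else Prod.swap) fun i => ?_
      split_ifs
      · exact MeasurePreserving.id _
      · exact Measure.measurePreserving_swap
    rw [← hp.measure_preimage (hBm _).nullMeasurableSet]
    congr 1
    ext Z
    simp only [hB, mem_ofPred_eq, mem_preimage]
    refine exists_congr fun q => ?_
    have : ∀ i ∈ Finset.univ, (if i ∈ T then 1 else -1) *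
        ((if ((if i ∈ T then id else Prod.swap) (Z i)).1 < q then 1 else 0) -
          (if ((if i ∈ T then id else Prod.swap) (Z i)).2 < q then (1 : ℝ) else 0)) =
      (if i ∈ Finset.univ then 1 else -1) *
        ((if (Z i).1 < q then 1 else 0) - (if (Z i).2 < q then (1 : ℝ) else 0)) := by
      intro i _
      by_cases hi : i ∈ T <;> simp [hi]
    rw [Finset.sum_congr rfl this]
  have hPi : Ξ (B Finset.univ) ≤ ENNReal.ofReal (4 * Real.exp (-(u ^ 2 / (8 * n)))) := by
    have h1 : ∑ T, Ξ (B T) ≤ ENNReal.ofReal (2 ^ n * (4 * Real.exp (-(u ^ 2 / (8 * n))))) := by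
      calc ∑ T, Ξ (B T) = ∫⁻ Z, ∑ T, (B T).indicator 1 Z ∂Ξ := by
            rw [lintegral_finsetSum _ fun T _ => measurable_one.indicator (hBm T)]
            simp_rw [lintegral_indicator_one (hBm _)]
        _ ≤ ∫⁻ _, ENNReal.ofReal (2 ^ n * (4 * Real.exp (-(u ^ 2 / (8 * n))))) ∂Ξ := by
            refine lintegral_mono fun Z => ?_
            refine le_trans (le_of_eq ?_)
              (ENNReal.ofReal_le_ofReal (sum_powerset_exists_lt_abs_sum hn Z hu))
            rw [ENNReal.ofReal_sum_of_nonneg fun T _ => by split_ifs <;> norm_num]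
            refine Finset.sum_congr rfl fun T _ => ?_
            simp only [indicator, hB, mem_ofPred_eq, Pi.one_apply]
            split_ifs <;> simp
        _ = _ := by simp [Ξ]
    simp_rw [hswap, Finset.sum_const, Finset.card_univ, Fintype.card_finset, Fintype.card_fin,
      nsmul_eq_mul] at h1
    rw [ENNReal.ofReal_mul (by positivity)] at h1
    have h2 : ENNReal.ofReal (2 ^ n) = ((2 ^ n : ℕ) : ℝ≥0∞) := by
      rw [← ENNReal.ofReal_natCast]; push_cast; rfl
    rw [h2] at h1
    exact (ENNReal.mul_le_mul_iff_right (by simp) (by simp)).1 h1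
  refine le_trans (le_of_eq ?_) hPi
  have hp := measurePreserving_arrowProdEquivProdArrow ℝ ℝ (Fin n) χ χ
  rw [← hp.measure_preimage_equiv]
  congr 1
  ext Z
  simp only [hB, mem_ofPred_eq, mem_preimage, Finset.mem_univ, if_true, one_mul]
  refine exists_congr fun q => ?_
  rw [rankFun_eq_sum, rankFun_eq_sum, ← Finset.sum_sub_distrib]
  rfl

/-! ### Deviation of the rank function from its mean, by comparison with a ghost sample. -/

section Deviation

variable {n : ℕ} (χ : Fin n → Measure ℝ) [∀ i, IsProbabilityMeasure (χ i)]

theorem integrable_indicator_lt (i : Fin n) (x : ℝ) :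
    Integrable (fun D : Fin n → ℝ => if D i < x then (1 : ℝ) else 0) (Measure.pi χ) := by
  refine Integrable.of_bound (C := 1) ?_ (.of_forall fun D => by split_ifs <;> simp)
  exact (Measurable.ite (measurableSet_lt (measurable_pi_apply i) measurable_const)
    measurable_const measurable_const).aestronglyMeasurable

theorem distRankFun_eq_sum (x : ℝ) : distRankFun χ x = ∑ i, distFun (χ i) x := by
  simp_rw [distRankFun, rankFun_eq_sum]
  rw [integral_finsetSum _ fun i _ => integrable_indicator_lt χ i x]
  refine Finset.sum_congr rfl fun i _ => ?_
  have h : (fun D : Fin n → ℝ => if D i < x then (1 : ℝ) else 0) =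
      ((fun D : Fin n → ℝ => D i) ⁻¹' Iio x).indicator fun _ => 1 := by
    funext D; simp [indicator]
  rw [h, integral_indicator_const _ (measurable_pi_apply i measurableSet_Iio), smul_eq_mul,
    mul_one, measureReal_def,
    (measurePreserving_eval χ i).measure_preimage measurableSet_Iio.nullMeasurableSet]
  rfl

/-- Chebyshev's inequality: a sum of `n` independent indicators has variance at most `n / 4`. -/
theorem pi_sqrt_le_abs_rankFun_sub (hn : 0 < n) (x : ℝ) :
    Measure.pi χ {D | √(n : ℝ) ≤ |rankFun D x - distRankFun χ x|} ≤ ENNReal.ofReal (1 / 2) := by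
  have hn' : (0 : ℝ) < n := by exact_mod_cast hn
  have hm : Measurable fun y : ℝ => if y < x then (1 : ℝ) else 0 :=
    Measurable.ite measurableSet_Iio measurable_const measurable_const
  have hL (i : Fin n) : MemLp (fun y : ℝ => if y < x then (1 : ℝ) else 0) 2 (χ i) :=
    MemLp.of_bound hm.aestronglyMeasurable 1 (.of_forall fun y => by split_ifs <;> simp)
  have hr : (fun D : Fin n → ℝ => rankFun D x) =
      ∑ i, fun D : Fin n → ℝ => if D i < x then (1 : ℝ) else 0 := by
    funext D; rw [rankFun_eq_sum, Finset.sum_apply]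
  have hv : ProbabilityTheory.variance (fun D : Fin n → ℝ => rankFun D x) (Measure.pi χ) ≤
      n / 4 := by
    rw [hr, ProbabilityTheory.variance_sum_pi hL]
    calc _ ≤ ∑ i : Fin n, ((1 - 0) / 2 : ℝ) ^ 2 := by
          refine Finset.sum_le_sum fun i _ => ProbabilityTheory.variance_le_sq_of_bounded
            (.of_forall fun y => ?_) hm.aemeasurable
          split_ifs <;> simp
      _ = n / 4 := by simp; ring
  have hLr : MemLp (fun D : Fin n → ℝ => rankFun D x) 2 (Measure.pi χ) := by
    refine MemLp.of_bound (measurable_rankFun x).aestronglyMeasurable n (.of_forall fun D => ?_)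
    rw [rankFun, Real.norm_natCast]
    exact_mod_cast (Finset.card_le_univ _).trans (by simp)
  refine (ProbabilityTheory.meas_ge_le_variance_div_sq hLr (Real.sqrt_pos.2 hn')).trans ?_
  refine ENNReal.ofReal_le_ofReal ?_
  rw [Real.sq_sqrt hn'.le, div_le_iff₀ hn']
  linarith

/-- If `D` deviates by more than `δ` at `q`, then with probability at least `1 / 2` an independent
copy is within `√n` of the mean at the same `q`, and the two rank functions differ there by more
than `δ - √n`. This doubles the constant `4`. Rational queries make the events measurable. -/
theorem pi_exists_rat_lt_abs_rankFun_sub (hn : 0 < n) {δ : ℝ} (hδ : √(n : ℝ) ≤ δ) :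
    Measure.pi χ {D | ∃ q : ℚ, δ < |rankFun D q - distRankFun χ q|} ≤
      ENNReal.ofReal (8 * Real.exp (-((δ - √(n : ℝ)) ^ 2 / (8 * n)))) := by
  set P := Measure.pi χ
  set G := {D : Fin n → ℝ | ∃ q : ℚ, δ < |rankFun D q - distRankFun χ q|} with hG
  set B := {p : (Fin n → ℝ) × (Fin n → ℝ) |
    ∃ q : ℚ, δ - √(n : ℝ) < |rankFun p.1 q - rankFun p.2 q|} with hB
  have hBm : MeasurableSet B := by
    simp only [hB, ofPred_exists]
    exact MeasurableSet.iUnion fun q => measurableSet_lt measurable_const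
      (((measurable_rankFun _).comp measurable_fst).sub
        ((measurable_rankFun _).comp measurable_snd)).abs
  have hGm : MeasurableSet G := by
    simp only [hG, ofPred_exists]
    exact MeasurableSet.iUnion fun q => measurableSet_lt measurable_const
      ((measurable_rankFun _).sub measurable_const).abs
  have hsec (D) (hD : D ∈ G) : ENNReal.ofReal (1 / 2) ≤ P (Prod.mk D ⁻¹' B) := by
    obtain ⟨q, hq⟩ := hD
    have hc := pi_sqrt_le_abs_rankFun_sub χ hn q
    have hm : MeasurableSet {D : Fin n → ℝ | √(n : ℝ) ≤ |rankFun D q - distRankFun χ q|} :=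
      measurableSet_le measurable_const ((measurable_rankFun _).sub measurable_const).abs
    have h1 : {D : Fin n → ℝ | √(n : ℝ) ≤ |rankFun D q - distRankFun χ q|}ᶜ ⊆
        Prod.mk D ⁻¹' B := by
      intro D' hD'
      simp only [mem_compl_iff, mem_ofPred_eq, not_le] at hD'
      refine ⟨q, ?_⟩
      have := abs_sub_abs_le_abs_sub (rankFun D q - distRankFun χ q)
        (rankFun D' q - distRankFun χ q)
      rw [sub_sub_sub_cancel_right] at this
      simp only
      linarith
    refine le_trans ?_ (measure_mono h1)
    rw [prob_compl_eq_one_sub hm]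
    refine le_trans ?_ (tsub_le_tsub_left hc 1)
    rw [← ENNReal.ofReal_one, ← ENNReal.ofReal_sub _ (by norm_num)]
    norm_num
  have h2 : ENNReal.ofReal (1 / 2) * P G ≤ P.prod P B := by
    rw [Measure.prod_apply hBm, ← setLIntegral_const]
    exact (setLIntegral_mono' hGm hsec).trans (setLIntegral_le_lintegral _ _)
  have h3 := h2.trans (prod_exists_lt_abs_rankFun_sub hn χ (sub_nonneg.2 hδ))
  have h4 : P G = ENNReal.ofReal 2 * (ENNReal.ofReal (1 / 2) * P G) := by
    rw [← mul_assoc, ← ENNReal.ofReal_mul (by norm_num)]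
    norm_num
  rw [h4]
  refine (mul_le_mul_right h3 _).trans (le_of_eq ?_)
  rw [← ENNReal.ofReal_mul (by norm_num)]
  congr 1
  ring

end Deviation

/-- The rank function is constant on an interval to the left of `x`. -/
theorem exists_lt_forall_rankFun_eq {n : ℕ} (D : Fin n → ℝ) (x : ℝ) :
    ∃ y < x, ∀ z, y < z → z ≤ x → rankFun D z = rankFun D x := by
  obtain ⟨y, hy, h⟩ : ∃ y < x, ∀ i, D i < x → D i ≤ y := by
    rcases (Finset.univ.filter fun i => D i < x).eq_empty_or_nonempty with h | h
    · refine ⟨x - 1, by linarith, fun i hi => ?_⟩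
      have : i ∈ Finset.univ.filter fun i => D i < x := by simp [hi]
      rw [h] at this
      simp at this
    · obtain ⟨i, hi, hmax⟩ := Finset.exists_max_image _ D h
      exact ⟨D i, by simpa using hi, fun j hj => hmax j (by simpa using hj)⟩
  refine ⟨y, hy, fun z hz hzx => ?_⟩
  simp only [rankFun]
  congr 2
  ext i
  simp only [Finset.mem_filter, Finset.mem_univ, true_and]
  exact ⟨fun hi => hi.trans_le hzx, fun hi => (h i hi).trans_lt hz⟩

theorem tendsto_distFun_nhdsLT (μ : Measure ℝ) [IsProbabilityMeasure μ] (x : ℝ) :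
    Filter.Tendsto (distFun μ) (nhdsWithin x (Iio x)) (nhds (distFun μ x)) := by
  have hmono : Monotone (distFun μ) := fun a b hab =>
    ENNReal.toReal_mono (measure_ne_top _ _) (measure_mono (Iio_subset_Iio hab))
  obtain ⟨u, hu, hux, hlim⟩ := exists_seq_strictMono_tendsto x
  have hlim' : Filter.Tendsto (fun k => distFun μ (u k)) Filter.atTop (nhds (distFun μ x)) := by
    have h : Iio x = ⋃ k, Iio (u k) := by
      ext y
      simp only [mem_Iio, mem_iUnion]
      exact ⟨fun hy => ((hlim.eventually (lt_mem_nhds hy)).exists),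
        fun ⟨k, hk⟩ => hk.trans (hux k)⟩
    refine (ENNReal.tendsto_toReal (measure_ne_top _ _)).comp ?_
    rw [h]
    exact tendsto_measure_iUnion_atTop fun a b hab => Iio_subset_Iio (hu.monotone hab)
  refine tendsto_order.2 ⟨fun a ha => ?_, fun a ha => ?_⟩
  · obtain ⟨k, hk⟩ := (hlim'.eventually (lt_mem_nhds ha)).exists
    filter_upwards [Ioo_mem_nhdsLT (hux k)] with y hy
    exact hk.trans_le (hmono hy.1.le)
  · filter_upwards [self_mem_nhdsWithin] with y hy
    exact (hmono (le_of_lt hy)).trans_lt ha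

/-- Ranks count records strictly below `x`, so both functions are left-continuous and a deviation at
`x` persists at some rational to the left of `x`. -/
theorem pi_exists_lt_abs_rankFun_sub {n : ℕ} (χ : Fin n → Measure ℝ)
    [∀ i, IsProbabilityMeasure (χ i)] (hn : 0 < n) {δ : ℝ} (hδ : √(n : ℝ) ≤ δ) :
    Measure.pi χ {D | ∃ x : ℝ, δ < |rankFun D x - distRankFun χ x|} ≤
      ENNReal.ofReal (8 * Real.exp (-((δ - √(n : ℝ)) ^ 2 / (8 * n)))) := by
  refine le_trans (measure_mono ?_) (pi_exists_rat_lt_abs_rankFun_sub χ hn hδ)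
  rintro D ⟨x, hx⟩
  obtain ⟨y, hy, hD⟩ := exists_lt_forall_rankFun_eq D x
  have hlim : Filter.Tendsto (fun z => |rankFun D x - distRankFun χ z|) (nhdsWithin x (Iio x))
      (nhds |rankFun D x - distRankFun χ x|) := by
    simp_rw [distRankFun_eq_sum]
    exact (tendsto_const_nhds.sub
      (tendsto_finsetSum _ fun i _ => tendsto_distFun_nhdsLT (χ i) x)).abs
  obtain ⟨w, hw, hsub⟩ := (mem_nhdsLT_iff_exists_Ioo_subset).1 (hlim.eventually (lt_mem_nhds hx))
  obtain ⟨q, hq, hqx⟩ := exists_rat_btwn (max_lt hy hw)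
  refine ⟨q, ?_⟩
  rw [hD q ((le_max_left _ _).trans_lt hq) hqx.le]
  exact hsub ⟨(le_max_right _ _).trans_lt hq, hqx⟩

/-! ### From deterministic accuracy to distribution learnability -/

theorem rankFun_comp_sort {n : ℕ} (D : Fin n → ℝ) (x : ℝ) :
    rankFun (D ∘ Tuple.sort D) x = rankFun D x := by
  simp only [rankFun_eq_sum, Function.comp]
  exact Equiv.sum_comp (Tuple.sort D) fun i => if D i < x then (1 : ℝ) else 0

theorem pi_not_forall_mem_Icc {n : ℕ} {χ : Fin n → Measure ℝ} (h : ∀ i, IsDataDistribution (χ i)) :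
    Measure.pi χ {D | ¬ ∀ i, D i ∈ Icc (0 : ℝ) 1} = 0 := by
  have := fun i => (h i).1
  have : {D : Fin n → ℝ | ¬ ∀ i, D i ∈ Icc (0 : ℝ) 1} =
      ⋃ i, (fun D : Fin n → ℝ => D i) ⁻¹' (Icc (0 : ℝ) 1)ᶜ := by
    ext D; simp
  rw [this, measure_iUnion_null_iff]
  intro i
  rw [(measurePreserving_eval χ i).measure_preimage measurableSet_Icc.compl.nullMeasurableSet]
  exact (h i).2

/-- With `δ = ε / 10` the error is at most `ε / 2 + 4 √n`, which is below `ε` when `ε ≥ 20 √n`. In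
this range `ε / 10 - √n ≥ ε / 20`, so the deviation exponent is at least `ε² / (3200 n)`. -/
theorem pi_le_iSup_abs_sub {n : ℕ} (hn : 1 ≤ n) {χ : Fin n → Measure ℝ}
    (hχ : ∀ i, IsDataDistribution (χ i)) {f : (Fin n → ℝ) → ℝ → ℝ}
    (hf : ∀ v : Fin n → ℝ, Monotone v → (∀ i, v i ∈ Icc (0 : ℝ) 1) → ∀ δ : ℝ,
      (∀ x, |rankFun v x - distRankFun χ x| ≤ δ) →
      ∀ x ∈ Icc (0 : ℝ) 1, |distRankFun χ x - f v x| ≤ 5 * δ + 4 * √(n : ℝ))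
    {ε : ℝ} (hε : √(n : ℝ) ≤ ε) :
    Measure.pi χ {D : Fin n → ℝ | ENNReal.ofReal ε ≤
      ⨆ x ∈ Icc (0 : ℝ) 1, ENNReal.ofReal |distRankFun χ x - f (D ∘ Tuple.sort D) x|} ≤
    ENNReal.ofReal (8 * Real.exp (-(1 / 3200) * (ε / √(n : ℝ) - 1) ^ 2)) := by
  have := fun i => (hχ i).1
  have hn' : (0 : ℝ) < n := by exact_mod_cast hn
  have hs : 0 < √(n : ℝ) := Real.sqrt_pos.2 hn'
  have hsq : √(n : ℝ) ^ 2 = n := Real.sq_sqrt hn'.le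
  have hq : 1 ≤ ε / √(n : ℝ) := (one_le_div hs).2 hε
  -- For smaller `ε` the claimed bound is at least `8 exp (-361 / 3200) ≥ 1`.
  rcases lt_or_ge ε (20 * √(n : ℝ)) with hlt | hge
  · refine prob_le_one.trans ?_
    rw [← ENNReal.ofReal_one]
    refine ENNReal.ofReal_le_ofReal ?_
    have hq' : ε / √(n : ℝ) < 20 := (div_lt_iff₀ hs).2 hlt
    have h1 : -1 ≤ -(1 / 3200) * (ε / √(n : ℝ) - 1) ^ 2 := by nlinarith
    have h2 := Real.add_one_le_exp (-(1 / 3200) * (ε / √(n : ℝ) - 1) ^ 2)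
    have h3 : (ε / √(n : ℝ) - 1) ^ 2 ≤ 361 := by nlinarith
    linarith
  have hsub : {D : Fin n → ℝ | ENNReal.ofReal ε ≤
      ⨆ x ∈ Icc (0 : ℝ) 1, ENNReal.ofReal |distRankFun χ x - f (D ∘ Tuple.sort D) x|} ⊆
      {D | ∃ x : ℝ, ε / 10 < |rankFun D x - distRankFun χ x|} ∪
        {D | ¬ ∀ i, D i ∈ Icc (0 : ℝ) 1} := by
    intro D hD
    by_contra hcon
    simp only [mem_union, mem_ofPred_eq, not_or, not_not, not_exists, not_lt] at hcon
    have h1 := hf _ (Tuple.monotone_sort D) (fun i => hcon.2 _) (ε / 10) fun x => by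
      rw [rankFun_comp_sort]; exact hcon.1 x
    have h2 : (⨆ x ∈ Icc (0 : ℝ) 1, ENNReal.ofReal |distRankFun χ x - f (D ∘ Tuple.sort D) x|) ≤
        ENNReal.ofReal (5 * (ε / 10) + 4 * √(n : ℝ)) :=
      iSup₂_le fun x hx => ENNReal.ofReal_le_ofReal (h1 x hx)
    have h3 := (ENNReal.ofReal_le_ofReal_iff (by linarith)).1 (le_trans hD h2)
    linarith
  refine (measure_mono hsub).trans ((measure_union_le _ _).trans ?_)
  rw [pi_not_forall_mem_Icc hχ, add_zero]
  refine (pi_exists_lt_abs_rankFun_sub χ hn (by linarith)).trans ?_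
  refine ENNReal.ofReal_le_ofReal ?_
  gcongr
  have h1 : (ε / √(n : ℝ) - 1) ^ 2 ≤ ε ^ 2 / n := by
    have h0 : ε ^ 2 / n = (ε / √(n : ℝ)) ^ 2 := by rw [div_pow, hsq]
    rw [h0]
    nlinarith
  have h2 : (ε / 20) ^ 2 / (8 * n) ≤ (ε / 10 - √(n : ℝ)) ^ 2 / (8 * n) := by
    gcongr
    · linarith
    · linarith
  have h3 : (ε / 20) ^ 2 / (8 * n) = 1 / 3200 * (ε ^ 2 / n) := by
    field_simp; ring
  linarith

/-- The output `y` is fixed before `χ` and `δ`, which the programs do not know; the accuracy must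
adapt to whatever `δ` bounds the deviation of this dataset. -/
theorem rankLearnable_of_forall_dataset {C : ℕ} {𝔖 : ∀ n : ℕ, Set (Fin n → Measure ℝ)}
    {T S B : ℕ → ℝ} (A E : Program) (hχ : ∀ n, ∀ χ ∈ 𝔖 n, ∀ i, IsDataDistribution (χ i))
    (h : ∀ n : ℕ, 1 ≤ n → ∀ v : Fin n → ℝ, Monotone v → (∀ i, v i ∈ Icc (0 : ℝ) 1) →
      ∃ (model : List ℕ) (k : ℕ),
        Trains A ⌊((n : ℝ) + S n) ^ C⌋₊ v model k ∧
        (k : ℝ) ≤ C * (n * B n) ∧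
        ((E.length : ℝ) + (bitSize model : ℝ)) ≤ C * S n ∧
        ∀ x ∈ Icc (0 : ℝ) 1, ∃ (j : ℕ) (y : ℝ),
          Evaluates E ⌊((n : ℝ) + S n) ^ C⌋₊ v model x j y ∧ (j : ℝ) ≤ C * T n ∧
          ∀ χ ∈ 𝔖 n, ∀ δ : ℝ, (∀ x, |rankFun v x - distRankFun χ x| ≤ δ) →
            |distRankFun χ x - y| ≤ 5 * δ + 4 * √(n : ℝ)) :
    RankLearnable 8 (1 / 3200) C 𝔖 T S B := by
  have h' : ∀ (n : ℕ) (v : Fin n → ℝ), ∃ f : ℝ → ℝ, 1 ≤ n → Monotone v →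
      (∀ i, v i ∈ Icc (0 : ℝ) 1) →
      (∃ (model : List ℕ) (k : ℕ),
        Trains A ⌊((n : ℝ) + S n) ^ C⌋₊ v model k ∧
        (k : ℝ) ≤ C * (n * B n) ∧
        ((E.length : ℝ) + (bitSize model : ℝ)) ≤ C * S n ∧
        ∀ x ∈ Icc (0 : ℝ) 1, ∃ j : ℕ,
          Evaluates E ⌊((n : ℝ) + S n) ^ C⌋₊ v model x j (f x) ∧ (j : ℝ) ≤ C * T n) ∧
      ∀ χ ∈ 𝔖 n, ∀ δ : ℝ, (∀ x, |rankFun v x - distRankFun χ x| ≤ δ) →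
        ∀ x ∈ Icc (0 : ℝ) 1, |distRankFun χ x - f x| ≤ 5 * δ + 4 * √(n : ℝ) := by
    intro n v
    by_cases hv : 1 ≤ n ∧ Monotone v ∧ ∀ i, v i ∈ Icc (0 : ℝ) 1
    · obtain ⟨model, k, h1, h2, h3, h4⟩ := h n hv.1 v hv.2.1 hv.2.2
      choose! j y h5 h6 h7 using h4
      exact ⟨y, fun _ _ _ => ⟨⟨model, k, h1, h2, h3, fun x hx => ⟨j x, h5 x hx, h6 x hx⟩⟩,
        fun χ hχ δ hδ x hx => h7 x hx χ hχ δ hδ⟩⟩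
    · exact ⟨fun _ => 0, fun h1 h2 h3 => (hv ⟨h1, h2, h3⟩).elim⟩
  choose f hf using h'
  refine ⟨A, E, f, fun n hn v hv hI => (hf n v hn hv hI).1, fun n hn χ hχn ε hε => ?_⟩
  exact pi_le_iSup_abs_sub hn (hχ n χ hχn) (fun v hv hI => (hf n v hn hv hI).2 χ hχn) hε

/-! ### A single distribution with a computable distribution function -/

theorem exists_rankLearnable_singleton {μ : Measure ℝ} (hμ : ConstantTimeCDF μ) :
    ∃ C : ℕ, RankLearnable 8 (1 / 3200) C (familiesIn {μ})
      (fun _ => 1) (fun _ => 1) (fun n => 1 / n) := by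
  obtain ⟨hD, P, W, K, hP⟩ := hμ
  refine ⟨W + K + P.length + 4, rankLearnable_of_forall_dataset [.halt] P.timesSize
    (fun n χ hχ i => by rw [show χ i = μ from hχ i]; exact hD) fun n hn v _ _ => ?_⟩
  set C := W + K + P.length + 4 with hC
  have hn' : (1 : ℝ) ≤ n := by exact_mod_cast hn
  -- The summand `W` of `C` makes room for the words of `P`, since `W ≤ 2 ^ W`.
  have hW : W ≤ ⌊((n : ℝ) + 1) ^ C⌋₊ := by
    refine Nat.le_floor ?_
    calc (W : ℝ) ≤ (2 : ℝ) ^ W := by exact_mod_cast Nat.lt_two_pow_self.le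
      _ ≤ ((n : ℝ) + 1) ^ W := by gcongr; linarith
      _ ≤ ((n : ℝ) + 1) ^ C := pow_le_pow_right₀ (by linarith) (by omega)
  have hnW : n ≤ ⌊((n : ℝ) + 1) ^ C⌋₊ := by
    refine Nat.le_floor ?_
    calc (n : ℝ) ≤ ((n : ℝ) + 1) ^ 1 := by linarith
      _ ≤ ((n : ℝ) + 1) ^ C := pow_le_pow_right₀ (by linarith) (by omega)
  refine ⟨[], 0, ⟨_, ⟨rfl, rfl⟩, rfl⟩, ?_, ?_, fun x hx => ?_⟩
  · simp only [Nat.cast_zero]; positivity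
  · simp only [Program.timesSize, bitSize, List.length_append, List.length_map, List.length_cons,
      List.length_nil, List.map_nil, List.sum_nil, hC]
    push_cast
    linarith [Nat.cast_nonneg (α := ℝ) W, Nat.cast_nonneg (α := ℝ) K]
  · obtain ⟨j, hj, s', hs, hy⟩ := hP x hx
    obtain ⟨j', hj', s'', hs', hy'⟩ := Program.timesSize_halts hW hnW v hs
    refine ⟨j', _, ⟨s'', hs', rfl⟩, ?_, fun χ hχ δ hδ => ?_⟩
    · rw [mul_one]; exact_mod_cast (by omega : j' ≤ C)
    · have hδ0 := (abs_nonneg _).trans (hδ 0)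
      have := hD.1
      have hχ' : χ = fun _ => μ := funext hχ
      subst hχ'
      rw [hy', hy, distRankFun_eq_sum, Finset.sum_const, Finset.card_univ, Fintype.card_fin,
        nsmul_eq_mul, mul_comm, sub_self, abs_zero]
      positivity

/-! ### Sorted datasets -/

/-- The record with index `i`, padded with ones. -/
noncomputable def recordAt {n : ℕ} (v : Fin n → ℝ) (i : ℕ) : ℝ := if h : i < n then v ⟨i, h⟩ else 1

theorem recordAt_of_lt {n : ℕ} (v : Fin n → ℝ) {i : ℕ} (h : i < n) : recordAt v i = v ⟨i, h⟩ :=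
  dif_pos h

section Sorted

variable {n : ℕ} {v : Fin n → ℝ} (hv : Monotone v) (hI : ∀ i, v i ∈ Icc (0 : ℝ) 1)
include hv

theorem rankFun_le_of_le_recordAt {x : ℝ} {p : ℕ} (h : x ≤ recordAt v p) : rankFun v x ≤ p := by
  rw [rankFun]
  norm_cast
  rcases lt_or_ge p n with hp | hp
  · rw [recordAt_of_lt v hp] at h
    calc _ ≤ (Finset.Iio (⟨p, hp⟩ : Fin n)).card := by
          refine Finset.card_le_card fun i hi => ?_
          simp only [Finset.mem_filter, Finset.mem_univ, true_and, Finset.mem_Iio] at hi ⊢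
          by_contra hc
          exact absurd (hi.trans_le h) (hv (not_lt.1 hc)).not_gt
      _ = p := by simp
  · exact (Finset.card_le_univ _).trans (by simpa using hp)

/-- The padding value `1` is never below a query `x ≤ 1`, so `p` is the index of an actual record.
-/
theorem lt_rankFun_of_recordAt_lt {x : ℝ} (hx : x ≤ 1) {p : ℕ} (h : recordAt v p < x) :
    (p : ℝ) + 1 ≤ rankFun v x := by
  rw [rankFun]
  norm_cast
  have hp : p < n := by
    by_contra hp
    rw [recordAt, dif_neg hp] at h
    exact absurd h hx.not_gt
  rw [recordAt_of_lt v hp] at h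
  calc p + 1 = (Finset.Iic (⟨p, hp⟩ : Fin n)).card := by simp
    _ ≤ _ := by
      refine Finset.card_le_card fun i hi => ?_
      simp only [Finset.mem_filter, Finset.mem_univ, true_and, Finset.mem_Iic] at hi ⊢
      exact (hv hi).trans_lt h

include hI

theorem recordAt_mono : Monotone (recordAt v) := by
  intro i j hij
  rcases lt_or_ge j n with hj | hj
  · rw [recordAt_of_lt v hj, recordAt_of_lt v (hij.trans_lt hj)]
    exact hv hij
  · rw [recordAt.eq_def v j, dif_neg hj.not_gt, recordAt]
    split_ifs
    · exact (hI _).2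
    · exact le_rfl

omit hv in
theorem recordAt_mem (i : ℕ) : recordAt v i ∈ Icc (0 : ℝ) 1 := by
  rw [recordAt]
  split_ifs
  · exact hI _
  · simp

end Sorted

/-! ### Rounding up a square root -/

/-- Computes `⌈√n⌉` in register `3`; the next instruction has number `7`. -/
def sqrtProgram : Program :=
  [.size 1, .natConst 2 1, .natMul 4 3 3, .jumpNatLt 4 1 5, .jump 7, .natAdd 3 3 2, .jump 2]

/-- Jump targets are absolute, hence the square root is computed by a prefix of fixed length, and
the remainder of the program enters as the continuation `H`. -/
theorem sqrtProgram_append_halts {P : Program} {W n k : ℕ} {data : Fin n → ℝ} {Q : Config → Prop}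
    {mem : ℕ → ℕ} {r : List ℝ} (hn : 1 ≤ n) (hW : 4 * n ≤ W)
    (H : ∀ s, 1 ≤ s → s ≤ n.sqrt + 1 → n ≤ s * s → (s - 1) * (s - 1) < n →
      (sqrtProgram ++ P).HaltsWithin W data
        ⟨7, regs [0, n, 1, s, s * s, 0, 0, 0, 0, 0, 0], regs r, mem⟩ k Q) :
    (sqrtProgram ++ P).HaltsWithin W data
      ⟨0, regs [0, 0, 0, 0, 0, 0, 0, 0, 0, 0, 0], regs r, mem⟩ (k + 4 * (n.sqrt + 1) + 5) Q := by
  have hsq : n.sqrt * n.sqrt ≤ n := Nat.sqrt_le n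
  have hsn : n.sqrt ≤ n := Nat.sqrt_le_self n
  have loop : ∀ f s q, s = 0 ∨ (s - 1) * (s - 1) < n → n.sqrt + 1 ≤ s + f →
      (sqrtProgram ++ P).HaltsWithin W data
        ⟨2, regs [0, n, 1, s, q, 0, 0, 0, 0, 0, 0], regs r, mem⟩ (k + 4 * f + 3) Q := by
    intro f
    induction f with
    | zero =>
      intro s q hs hf
      have h1 : n < s * s := Nat.sqrt_lt.1 (by omega)
      have h2 : s ≤ n.sqrt + 1 := by
        rcases hs with rfl | hs
        · omega
        · have := Nat.le_sqrt.2 hs.le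
          omega
      have hs0 : 1 ≤ s := by omega
      have hss : s * s ≤ W := by nlinarith
      refine .natMul rfl rfl hss ?_
      refine .jumpNatLt_neg rfl (show ¬ s * s < n by omega) ?_
      exact .jump rfl (H s hs0 h2 h1.le (by rcases hs with rfl | hs <;> omega))
    | succ f ih =>
      intro s q hs hf
      have h2 : s ≤ n.sqrt + 1 := by
        rcases hs with rfl | hs
        · omega
        · have := Nat.le_sqrt.2 hs.le
          omega
      have hss : s * s ≤ W := by nlinarith
      rw [show k + 4 * (f + 1) + 3 = k + 4 * f + 3 + 1 + 1 + 1 + 1 by ring]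
      refine .natMul rfl rfl hss ?_
      by_cases hlt : s * s < n
      · refine .jumpNatLt_pos rfl hlt ?_
        refine .natAdd rfl rfl (show s + 1 ≤ W by omega) ?_
        exact .jump rfl (ih (s + 1) _ (.inr (by simpa using hlt)) (by omega))
      · have hs0 : 1 ≤ s := by
          by_contra h
          obtain rfl : s = 0 := by omega
          omega
        refine .jumpNatLt_neg rfl hlt ?_
        exact .mono (.jump rfl (H s hs0 h2 (by omega) (by rcases hs with rfl | hs <;> omega)))
          (by omega)
  have h0 := loop (n.sqrt + 1) 0 0 (.inl rfl) (by omega)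
  rw [show k + 4 * (n.sqrt + 1) + 5 = k + 4 * (n.sqrt + 1) + 3 + 1 + 1 by ring]
  refine .size rfl rfl (by omega) ?_
  exact .natConst rfl rfl (by omega) h0

/-! ### Distributions with a bounded density: ranks on a grid -/

/-- Stores `M = R ⌈√n⌉`, followed by approximate ranks of the points `j / M` for `j ≤ M`, found
by scanning every `⌈√n⌉`-th record. -/
def gridTraining (R : ℕ) : Program := sqrtProgram ++
  [.natConst 5 R, .natMul 5 5 3, .natStore 6 5, .natAdd 0 5 2, .natAdd 0 0 2, .realOfNat 1 5,
   .jumpNatLt 5 7 25, .jumpNatLt 8 1 16, .jump 20,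
   .realData 2 8, .realOfNat 3 7, .realDiv 3 3 1, .jumpRealLt 2 3 23,
   .natAdd 7 7 2, .natStore 7 8, .jump 13,
   .natAdd 8 8 3, .jump 13,
   .halt]

/-- Looks up the stored rank of `⌊x M⌋ / M`. -/
def gridEvaluation : Program :=
  [.natLoad 1 0, .realOfNat 1 1, .realMul 0 0 1, .realFloor 2 0, .natConst 3 1, .natAdd 2 2 3,
   .natLoad 4 2, .realOfNat 0 4, .halt]

/-- Two increasing sequences are merged, the points `j / M` and the records with index `s c`. If
record `s (c - 1)` is below `j / M` and record `s c` is not, the rank of `j / M` lies between `s (c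
- 1) + 1` and `s c`, so storing `s c` errs by less than `s`. -/
theorem gridTraining_halts {W n R : ℕ} (hn : 1 ≤ n) (hR : 1 ≤ R) {v : Fin n → ℝ} (hv : Monotone v)
    (hW : 2 * (R * n) + 4 * n + 2 ≤ W) :
    (gridTraining R).HaltsWithin W v ⟨0, fun _ => 0, fun _ => 0, fun _ => 0⟩
      (9 * ((R + 1) * (n.sqrt + 1) + 1) + 4 * (n.sqrt + 1) + 12)
      fun c => ∃ s, 1 ≤ s ∧ n ≤ s * s ∧ (s - 1) * (s - 1) < n ∧ c.nat 0 = R * s + 2 ∧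
        c.mem 0 = R * s ∧ ∀ j ≤ R * s, c.mem (j + 1) ≤ s * s ∧
          |(c.mem (j + 1) : ℝ) - rankFun v (j / ((R * s : ℕ) : ℝ))| ≤ s := by
  rw [regs_zero 11, regs_zero (α := ℝ) 4]
  rw [show 9 * ((R + 1) * (n.sqrt + 1) + 1) + 4 * (n.sqrt + 1) + 12 =
    (9 * ((R + 1) * (n.sqrt + 1) + 1) + 1 + 6) + 4 * (n.sqrt + 1) + 5 by ring]
  refine sqrtProgram_append_halts hn (by omega) fun s hs1 hs2 hns hsn => ?_
  have hs : s ≤ 2 * n := by have := Nat.sqrt_le_self n; omega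
  have hss : s * s ≤ 4 * n := by
    obtain ⟨t, rfl⟩ : ∃ t, s = t + 1 := ⟨s - 1, by omega⟩
    have : t ≤ n.sqrt := by omega
    have := Nat.sqrt_le_self n
    simp only [Nat.add_sub_cancel] at hsn
    nlinarith
  have hRs : R * s ≤ 2 * (R * n) := by
    calc R * s ≤ R * (2 * n) := Nat.mul_le_mul_left _ hs
      _ = _ := by ring
  have hRn : R ≤ R * n := Nat.le_mul_of_pos_right _ hn
  set M := R * s with hM
  have hM1 : 1 ≤ M := Nat.mul_pos hR hs1
  have hM0 : (0 : ℝ) < M := by exact_mod_cast hM1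
  -- Every iteration advances `j` or `c` by one, so `f` only has to cover `M + 1 + s - j - c`. The
  -- rank of point `j` goes to cell `j + 1`, cell `0` being taken by `M`.
  have loop : ∀ f j c (y z : ℝ) (mem : ℕ → ℕ), j ≤ M + 1 → c ≤ s →
      (c = 0 ∨ recordAt v (s * (c - 1)) < j / (M : ℝ)) → M + 1 + s ≤ j + c + f → mem 0 = M →
      (∀ i < j, mem (i + 1) ≤ s * s ∧ |(mem (i + 1) : ℝ) - rankFun v (i / (M : ℝ))| ≤ s) →
      (gridTraining R).HaltsWithin W v
        ⟨13, regs [M + 2, n, 1, s, s * s, M, 0, j, s * c, 0, 0], regs [0, M, y, z], mem⟩ (9 * f + 1)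
        fun c => ∃ s, 1 ≤ s ∧ n ≤ s * s ∧ (s - 1) * (s - 1) < n ∧ c.nat 0 = R * s + 2 ∧
          c.mem 0 = R * s ∧ ∀ j ≤ R * s, c.mem (j + 1) ≤ s * s ∧
            |(c.mem (j + 1) : ℝ) - rankFun v (j / ((R * s : ℕ) : ℝ))| ≤ s := by
    intro f
    induction f with
    | zero =>
      intro j c y z mem hj hc hcj hf hm0 hmem
      refine .jumpNatLt_pos rfl (show M < j by omega) ?_
      exact .halt rfl ⟨s, hs1, hns, hsn, rfl, hm0, fun i hi => hmem i (by omega)⟩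
    | succ f ih =>
      intro j c y z mem hj hc hcj hf hm0 hmem
      rw [show 9 * (f + 1) + 1 = 9 * f + 1 + 1 + 1 + 1 + 1 + 1 + 1 + 1 + 1 + 1 by ring]
      rcases Nat.lt_or_ge M j with hMj | hjM
      · refine .jumpNatLt_pos rfl hMj ?_
        exact .halt rfl ⟨s, hs1, hns, hsn, rfl, hm0, fun i hi => hmem i (by omega)⟩
      have hx1 : (j : ℝ) / M ≤ 1 := (div_le_one hM0).2 (by exact_mod_cast hjM)
      have hcs : s * c ≤ s * s := Nat.mul_le_mul_left _ hc
      have store (y z : ℝ) (hp : (j : ℝ) / M ≤ recordAt v (s * c)) :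
          (gridTraining R).HaltsWithin W v
            ⟨20, regs [M + 2, n, 1, s, s * s, M, 0, j, s * c, 0, 0], regs [0, M, y, z], mem⟩
            (9 * f + 1 + 1 + 1 + 1)
            fun c => ∃ s, 1 ≤ s ∧ n ≤ s * s ∧ (s - 1) * (s - 1) < n ∧ c.nat 0 = R * s + 2 ∧
              c.mem 0 = R * s ∧ ∀ j ≤ R * s, c.mem (j + 1) ≤ s * s ∧
                |(c.mem (j + 1) : ℝ) - rankFun v (j / ((R * s : ℕ) : ℝ))| ≤ s := by
        refine .natAdd rfl rfl (show j + 1 ≤ W by omega) ?_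
        refine .natStore rfl ?_
        refine .jump rfl (ih (j + 1) c _ _ _ (by omega) hc ?_ (by omega) ?_ ?_)
        · refine hcj.imp_right fun h => h.trans_le ?_
          gcongr
          omega
        · exact hm0
        · intro i hi
          change Function.update mem (j + 1) (s * c) (i + 1) ≤ s * s ∧
            |((Function.update mem (j + 1) (s * c) (i + 1) : ℕ) : ℝ) - rankFun v (i / (M : ℝ))| ≤ s
          rcases Nat.lt_succ_iff_lt_or_eq.1 hi with hi | rfl
          · rw [Function.update_of_ne (by omega)]
            exact hmem i hi
          · rw [Function.update_self]
            refine ⟨hcs, ?_⟩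
            have h1 := rankFun_le_of_le_recordAt hv hp
            have h2 : (0 : ℝ) ≤ rankFun v ((i : ℝ) / M) := Nat.cast_nonneg _
            rw [abs_of_nonneg (by linarith)]
            rcases hcj with rfl | hcj
            · simp only [mul_zero, Nat.cast_zero, zero_sub]
              linarith [Nat.cast_nonneg (α := ℝ) s]
            · have h3 := lt_rankFun_of_recordAt_lt hv hx1 hcj
              rcases Nat.eq_zero_or_pos c with rfl | hc0
              · simp only [mul_zero, Nat.cast_zero, zero_sub]
                linarith [Nat.cast_nonneg (α := ℝ) s]
              · obtain ⟨c, rfl⟩ : ∃ d, c = d + 1 := ⟨c - 1, by omega⟩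
                simp only [Nat.add_sub_cancel] at h3
                push_cast at h3 ⊢
                linarith
      refine .jumpNatLt_neg rfl (show ¬ M < j by omega) ?_
      by_cases hp : s * c < n
      · refine .jumpNatLt_pos rfl hp ?_
        refine .realData rfl rfl hp ?_
        refine .realOfNat rfl rfl ?_
        refine .realDiv rfl rfl hM0.ne' ?_
        by_cases hlt : v ⟨s * c, hp⟩ < (j : ℝ) / M
        · refine .jumpRealLt_pos rfl hlt ?_
          have hc' : c + 1 ≤ s := by
            by_contra h
            have : c = s := by omega
            subst this
            omega
          refine .natAdd rfl rfl (show s * c + s ≤ W by nlinarith) ?_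
          refine .mono (.jump rfl (ih j (c + 1) (v ⟨s * c, hp⟩) (j / M) mem hj hc' ?_
            (by omega) hm0 hmem)) (by omega)
          right
          simpa [recordAt_of_lt v hp] using hlt
        · refine .jumpRealLt_neg rfl hlt ?_
          exact .mono (store _ _ (by rw [recordAt_of_lt v hp]; exact not_lt.1 hlt)) (by omega)
      · refine .jumpNatLt_neg rfl hp ?_
        refine .jump rfl ?_
        exact .mono (store _ _ (by rw [recordAt, dif_neg hp]; exact hx1)) (by omega)
  refine .natConst rfl rfl (by omega) ?_
  refine .natMul rfl rfl (show R * s ≤ W by omega) ?_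
  refine .natStore rfl ?_
  refine .natAdd rfl rfl (show M + 1 ≤ W by omega) ?_
  refine .natAdd rfl rfl (show M + 1 + 1 ≤ W by omega) ?_
  refine .realOfNat rfl rfl ?_
  refine .mono (loop ((R + 1) * (n.sqrt + 1) + 1) 0 0 0 0 _ (by omega) (by omega) (.inl rfl) ?_
    rfl fun i hi => absurd hi (Nat.not_lt_zero i)) le_rfl
  have : (R + 1) * s ≤ (R + 1) * (n.sqrt + 1) := Nat.mul_le_mul_left _ hs2
  have : (R + 1) * s = M + s := by rw [hM]; ring
  omega

theorem gridEvaluation_halts {W n M : ℕ} {data : Fin n → ℝ} {mem : ℕ → ℕ} {x : ℝ}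
    (hx : x ∈ Icc (0 : ℝ) 1) (hm0 : mem 0 = M) (hM : M + 1 ≤ W) (hmem : ∀ j ≤ M, mem (j + 1) ≤ W) :
    gridEvaluation.HaltsWithin W data ⟨0, fun _ => 0, Function.update (fun _ => 0) 0 x, mem⟩ 8
      fun c => c.real 0 = mem (⌊x * M⌋₊ + 1) := by
  have h0 : 0 ≤ x * M := mul_nonneg hx.1 (Nat.cast_nonneg _)
  have hfl : ⌊x * M⌋₊ ≤ M :=
    Nat.floor_le_of_le (mul_le_of_le_one_left (Nat.cast_nonneg _) hx.2)
  rw [regs_zero 5, regs_cons x 1]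
  refine .natLoad rfl rfl (show mem 0 ≤ W by omega) ?_
  change gridEvaluation.HaltsWithin W data
    ⟨1, regs [0, mem 0, 0, 0, 0], regs [x, 0], mem⟩ _ _
  rw [hm0]
  refine .realOfNat rfl rfl ?_
  refine .realMul rfl rfl ?_
  refine .realFloor rfl rfl h0 (show ⌊x * M⌋₊ ≤ W by omega) ?_
  refine .natConst rfl rfl (by omega) ?_
  refine .natAdd rfl rfl (show ⌊x * M⌋₊ + 1 ≤ W by omega) ?_
  refine .natLoad rfl rfl (hmem _ hfl) ?_
  refine .realOfNat rfl rfl ?_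
  exact .halt rfl rfl

/-! ### Size estimates -/

theorem le_log_two : (0.69 : ℝ) ≤ Real.log 2 := by linarith [Real.log_two_gt_d9]

theorem le_log_add_one {n : ℕ} (hn : 1 ≤ n) : (0.69 : ℝ) ≤ Real.log (n + 1) := by
  have hn' : (1 : ℝ) ≤ n := by exact_mod_cast hn
  exact le_log_two.trans (Real.log_le_log (by norm_num) (by linarith))

theorem natLog_two_le {m : ℕ} : (Nat.log 2 m : ℝ) ≤ 1.5 * Real.log (m + 1) := by
  have h2 := le_log_two
  rcases Nat.eq_zero_or_pos m with rfl | hm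
  · simp
  have hm' : (0 : ℝ) < m := by exact_mod_cast hm
  have h1 : (Nat.log 2 m : ℝ) * Real.log 2 ≤ Real.log m := by
    rw [← Real.log_pow]
    exact Real.log_le_log (by positivity) (by exact_mod_cast Nat.pow_log_le_self 2 hm.ne')
  have h3 : Real.log m ≤ Real.log (m + 1) := Real.log_le_log hm' (by linarith)
  have h4 : (0 : ℝ) ≤ Nat.log 2 m := Nat.cast_nonneg _
  nlinarith

/-- The base is at least `1.69`; ten factors contribute `1.69 ^ 10`, which outweighs `100 / 0.69`,
and two more dominate `0.69 a` and `n`. -/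
theorem le_floor_pow {n : ℕ} (hn : 1 ≤ n) {a S : ℝ} (ha : 1 ≤ a) (hS : a * 0.69 ≤ S) {C : ℕ}
    (hC : 12 ≤ C) {m : ℕ} (hm : (m : ℝ) ≤ 100 * (a * n)) : m ≤ ⌊((n : ℝ) + S) ^ C⌋₊ := by
  have hn' : (1 : ℝ) ≤ n := by exact_mod_cast hn
  refine Nat.le_floor (hm.trans ?_)
  have h1 : (1.69 : ℝ) ≤ n + S := by linarith
  calc 100 * (a * n) ≤ (1.69 : ℝ) ^ 10 * ((a * 0.69) * n) := by
        have : 0 < a * n := by positivity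
        norm_num
        nlinarith
    _ ≤ ((n : ℝ) + S) ^ 10 * ((n + S) * (n + S)) := by
        gcongr <;> linarith
    _ = ((n : ℝ) + S) ^ 12 := by ring
    _ ≤ _ := pow_le_pow_right₀ (by linarith) hC

/-- Cell `0` holds a count comparable with the number of other cells, so charging its value instead
of its logarithm is harmless. -/
theorem bitSize_map_range_succ_le {L b : ℕ} {mem : ℕ → ℕ}
    (h : ∀ i < L, Nat.log 2 (mem (i + 1)) + 1 ≤ b) :
    bitSize ((List.range (L + 1)).map mem) ≤ mem 0 + 1 + L * b := by
  rw [bitSize, List.map_map, List.range_succ_eq_map, List.map_cons, List.sum_cons, List.map_map]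
  refine add_le_add (Nat.succ_le_succ (Nat.log_le_self 2 _)) ?_
  refine (List.sum_le_card_nsmul _ b ?_).trans (by simp)
  intro x hx
  obtain ⟨i, hi, rfl⟩ := List.mem_map.1 hx
  exact h i (List.mem_range.1 hi)

theorem getD_map_range {L i : ℕ} (mem : ℕ → ℕ) (h : i < L) :
    ((List.range L).map mem).getD i 0 = mem i := by
  simp [List.getD_eq_getElem?_getD, h]

theorem cast_sqrt_le (n : ℕ) : (n.sqrt : ℝ) ≤ √(n : ℝ) := Real.nat_sqrt_le_real_sqrt

theorem cast_le_sqrt_add_one {n s : ℕ} (h : (s - 1) * (s - 1) < n) : (s : ℝ) ≤ √(n : ℝ) + 1 := by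
  have h1 : s ≤ n.sqrt + 1 := by
    have := Nat.le_sqrt.2 h.le
    omega
  have h2 : (s : ℝ) ≤ n.sqrt + 1 := by exact_mod_cast h1
  linarith [cast_sqrt_le n]

theorem sqrt_le_cast {n s : ℕ} (h : n ≤ s * s) : √(n : ℝ) ≤ s := by
  rw [Real.sqrt_le_left (Nat.cast_nonneg _), sq]
  exact_mod_cast h

/-! ### Learnability of distributions with a bounded density -/

theorem distFun_sub_le_of_boundedDensity {ρ : ℝ} (hρ : 0 ≤ ρ) {μ : Measure ℝ}
    (hμ : μ ∈ BoundedDensity ρ) {x y : ℝ} (hxy : x ≤ y) :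
    0 ≤ distFun μ y - distFun μ x ∧ distFun μ y - distFun μ x ≤ ρ * (y - x) := by
  obtain ⟨⟨hp, -⟩, g, hg, hb, rfl⟩ := hμ
  set μ := (volume : Measure ℝ).withDensity g
  have h1 : distFun μ y - distFun μ x = (μ (Ico x y)).toReal := by
    have h := measureReal_union (μ := μ) (s₁ := Iio x) (s₂ := Ico x y)
      (Set.disjoint_left.2 fun z hz hz' => absurd hz hz'.1.not_gt) measurableSet_Ico
    rw [Iio_union_Ico_eq_Iio hxy] at h
    simp only [measureReal_def] at h
    rw [distFun, distFun, h]
    ring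
  rw [h1]
  refine ⟨ENNReal.toReal_nonneg, ENNReal.toReal_le_of_le_ofReal
    (mul_nonneg hρ (sub_nonneg.2 hxy)) ?_⟩
  rw [withDensity_apply _ measurableSet_Ico]
  calc _ ≤ ∫⁻ _ in Ico x y, ENNReal.ofReal ρ := lintegral_mono hb
    _ = _ := by
      rw [setLIntegral_const, Real.volume_Ico, ENNReal.ofReal_mul hρ]

theorem distRankFun_sub_le_of_boundedDensity {ρ : ℝ} (hρ : 0 ≤ ρ) {n : ℕ} {χ : Fin n → Measure ℝ}
    (hχ : ∀ i, χ i ∈ BoundedDensity ρ) {x y : ℝ} (hxy : x ≤ y) :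
    |distRankFun χ y - distRankFun χ x| ≤ n * (ρ * (y - x)) := by
  have := fun i => (hχ i).1.1
  have h := fun i => distFun_sub_le_of_boundedDensity hρ (hχ i) hxy
  rw [distRankFun_eq_sum, distRankFun_eq_sum, ← Finset.sum_sub_distrib,
    abs_of_nonneg (Finset.sum_nonneg fun i _ => (h i).1)]
  refine (Finset.sum_le_sum fun i _ => (h i).2).trans (le_of_eq ?_)
  simp

/-- Rounding `x` to the grid costs at most `n ρ / M ≤ √n`, the stored rank at most `s ≤ 2 √n`, and
the passage between the two rank functions `δ`. -/
theorem abs_distRankFun_sub_le_of_grid {ρ : ℝ} (hρ : 1 ≤ ρ) {n s M : ℕ} {χ : Fin n → Measure ℝ}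
    (hχ : ∀ i, χ i ∈ BoundedDensity ρ) (hM : 0 < M) (hρM : ρ * √(n : ℝ) ≤ M)
    (hs : (s : ℝ) ≤ 2 * √(n : ℝ)) {v : Fin n → ℝ} {δ x y : ℝ}
    (hδ : ∀ x, |rankFun v x - distRankFun χ x| ≤ δ) (hx : 0 ≤ x)
    (hy : |y - rankFun v ((⌊x * M⌋₊ : ℕ) / (M : ℝ))| ≤ s) :
    |distRankFun χ x - y| ≤ 5 * δ + 4 * √(n : ℝ) := by
  have hM0 : (0 : ℝ) < M := by exact_mod_cast hM
  have hx0 : 0 ≤ x * M := mul_nonneg hx hM0.le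
  have h2 := hδ ((⌊x * M⌋₊ : ℕ) / (M : ℝ))
  have hn0 : (0 : ℝ) ≤ n := Nat.cast_nonneg n
  have hqq : √(n : ℝ) * √(n : ℝ) = n := Real.mul_self_sqrt hn0
  have hfl := Nat.lt_floor_add_one (x * M)
  have hfl' := Nat.floor_le hx0
  generalize (⌊x * M⌋₊ : ℝ) = i at *
  have h3 : i / M ≤ x := (div_le_iff₀ hM0).2 hfl'
  have h4 := distRankFun_sub_le_of_boundedDensity (by linarith) hχ h3
  have h5 : x - i / M ≤ 1 / M := by
    rw [sub_le_iff_le_add, ← add_div, le_div_iff₀ hM0]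
    linarith
  have h6 : (n : ℝ) * (ρ * (x - i / M)) ≤ √(n : ℝ) := by
    calc _ ≤ (n : ℝ) * (ρ * (1 / M)) := by gcongr
      _ = n * ρ / M := by ring
      _ ≤ √(n : ℝ) := by
        rw [div_le_iff₀ hM0]
        calc n * ρ = √(n : ℝ) * (ρ * √(n : ℝ)) := by linear_combination (-ρ) * hqq
          _ ≤ _ := by gcongr
  have hδ0 := (abs_nonneg _).trans (hδ 0)
  rw [abs_le] at hy h2 h4 ⊢
  constructor <;> linarith

/-- The numerical estimates for the size of a grid model and the time to compute it. -/
theorem grid_estimates {n R s : ℕ} (hn : 1 ≤ n) {ρ : ℝ} (hρ : 1 ≤ ρ) (hR : (R : ℝ) ≤ 2 * ρ)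
    (hs : (s : ℝ) ≤ 2 * √(n : ℝ)) :
    ((R * s : ℕ) : ℝ) ≤ 4 * (ρ * √(n : ℝ)) ∧ √(n : ℝ) ≤ n ∧
    ((9 * ((R + 1) * (n.sqrt + 1) + 1) + 4 * (n.sqrt + 1) + 12 : ℕ) : ℝ) ≤
      1000 * (ρ * √(n : ℝ) * Real.log (n + 1)) ∧
    9 + ((R * s + 1 + (R * s + 1) * (Nat.log 2 n + 3) : ℕ) : ℝ) ≤
      1000 * (ρ * √(n : ℝ) * Real.log (n + 1)) := by
  have hn' : (1 : ℝ) ≤ n := by exact_mod_cast hn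
  have hq : (1 : ℝ) ≤ √(n : ℝ) := Real.one_le_sqrt.2 hn'
  have hqq : √(n : ℝ) * √(n : ℝ) = n := Real.mul_self_sqrt (by linarith)
  have hlog := le_log_add_one hn
  have hσ := cast_sqrt_le n
  have hlg : (Nat.log 2 n : ℝ) ≤ 1.5 * Real.log (n + 1) := natLog_two_le
  have hM : ((R * s : ℕ) : ℝ) ≤ 4 * (ρ * √(n : ℝ)) := by
    push_cast
    calc (R : ℝ) * s ≤ (2 * ρ) * (2 * √(n : ℝ)) := by gcongr
      _ = _ := by ring
  have hqρ : √(n : ℝ) ≤ ρ * √(n : ℝ) := by nlinarith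
  have hS : ρ * √(n : ℝ) * 0.69 ≤ ρ * √(n : ℝ) * Real.log (n + 1) := by gcongr
  refine ⟨hM, by nlinarith, ?_, ?_⟩
  · have h3 : ((R : ℝ) + 1) * (n.sqrt + 1) ≤ (3 * ρ) * (2 * √(n : ℝ)) := by
      gcongr <;> linarith
    push_cast
    linarith
  · have h1 : ((R * s : ℕ) + 1 : ℝ) * (Nat.log 2 n + 4) ≤
        (5 * (ρ * √(n : ℝ))) * (8 * Real.log (n + 1)) := by
      gcongr <;> linarith
    push_cast at h1 ⊢
    linarith

theorem rankLearnable_boundedDensity {C : ℕ} (hC : 1000 ≤ C) {ρ : ℝ} (hρ : 1 ≤ ρ) :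
    RankLearnable 8 (1 / 3200) C (familiesIn (BoundedDensity ρ))
      (fun _ => 1)
      (fun n => ρ * √(n : ℝ) * Real.log (n + 1))
      (fun n => ρ * √(n : ℝ) * Real.log (n + 1) / n) := by
  set R := ⌈ρ⌉₊ with hRdef
  refine rankLearnable_of_forall_dataset (gridTraining R) gridEvaluation
    (fun n χ hχ i => (hχ i).1) fun n hn v hv hI => ?_
  have hn' : (1 : ℝ) ≤ n := by exact_mod_cast hn
  have hq : (1 : ℝ) ≤ √(n : ℝ) := Real.one_le_sqrt.2 hn'
  have hqq : √(n : ℝ) * √(n : ℝ) = n := Real.mul_self_sqrt (by linarith)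
  have hlog := le_log_add_one hn
  have hC' : (1000 : ℝ) ≤ C := by exact_mod_cast hC
  have hR1 : 1 ≤ R := Nat.ceil_pos.2 (by linarith)
  have hR2 : (R : ℝ) ≤ 2 * ρ := by linarith [Nat.ceil_lt_add_one (by linarith : 0 ≤ ρ)]
  have hR3 : ρ ≤ R := Nat.le_ceil ρ
  have hS : ρ * 0.69 ≤ ρ * √(n : ℝ) * Real.log (n + 1) := by
    rw [mul_assoc]
    gcongr
    nlinarith
  have hSpos : 0 ≤ ρ * √(n : ℝ) * Real.log (n + 1) := by linarith
  generalize hWdef : ⌊((n : ℝ) + ρ * √(n : ℝ) * Real.log (n + 1)) ^ C⌋₊ = W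
  have hW : ∀ m : ℕ, (m : ℝ) ≤ 100 * (ρ * n) → m ≤ W := fun m hm => by
    rw [← hWdef]; exact le_floor_pow hn hρ hS (by omega) hm
  have hnρ : (n : ℝ) ≤ ρ * n := by nlinarith
  have hRn : (R : ℝ) * n ≤ 2 * (ρ * n) := by nlinarith
  obtain ⟨k, hk, s', hs', s, hs1, hns, hsn, hL, hm0, hmem⟩ :=
    gridTraining_halts (W := W) hn hR1 hv (hW _ (by push_cast; linarith))
  have hsq : (s : ℝ) ≤ 2 * √(n : ℝ) := by linarith [cast_le_sqrt_add_one hsn]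
  have hss : s * s ≤ 4 * n := by
    have : (s : ℝ) * s ≤ 4 * n := by nlinarith [Nat.cast_nonneg (α := ℝ) s]
    exact_mod_cast this
  obtain ⟨hM, hsqn, hE1, hE2⟩ := grid_estimates hn hρ hR2 hsq
  refine ⟨_, k, ⟨s', hs', rfl⟩, ?_, ?_, fun x hx => ?_⟩
  · have h1 : (k : ℝ) ≤ _ := Nat.cast_le.2 hk
    rw [mul_div_cancel₀ _ (by positivity)]
    exact h1.trans (hE1.trans (by gcongr))
  · have h1 : bitSize ((List.range (s'.nat 0)).map s'.mem) ≤
        R * s + 1 + (R * s + 1) * (Nat.log 2 n + 3) := by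
      rw [hL, ← hm0]
      refine bitSize_map_range_succ_le fun i hi => ?_
      -- Stored ranks are at most `s * s ≤ 4 n`, which costs two bits more than `n`.
      have h1 : Nat.log 2 (s'.mem (i + 1)) ≤ Nat.log 2 (n * 2 * 2) :=
        Nat.log_mono_right (((hmem i (by omega)).1.trans hss).trans (by omega))
      rw [Nat.log_mul_base (by norm_num) (by omega),
        Nat.log_mul_base (by norm_num) (by omega)] at h1
      omega
    have h2 : ((bitSize ((List.range (s'.nat 0)).map s'.mem) : ℕ) : ℝ) ≤ _ := Nat.cast_le.2 h1
    refine (add_le_add_right h2 _).trans ((le_of_eq ?_).trans (hE2.trans (by gcongr)))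
    norm_num [gridEvaluation]
  · have hMW : R * s + 1 ≤ W := hW _ (by
      rw [Nat.cast_add, Nat.cast_one]; nlinarith)
    have hget : ∀ i < R * s + 2, ((List.range (s'.nat 0)).map s'.mem).getD i 0 = s'.mem i :=
      fun i hi => getD_map_range _ (by omega)
    have hsW : s * s ≤ W := hss.trans (hW _ (by push_cast; linarith))
    obtain ⟨j, hj, c, hc, hy⟩ := gridEvaluation_halts (W := W) (data := v)
      (mem := fun i => ((List.range (s'.nat 0)).map s'.mem).getD i 0) hx
      ((hget 0 (by omega)).trans hm0) hMW fun j hj => by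
        rw [hget _ (by omega)]
        exact (hmem j hj).1.trans hsW
    refine ⟨j, _, ⟨c, hc, rfl⟩, ?_, fun χ hχ δ hδ => ?_⟩
    · have : (j : ℝ) ≤ 8 := by exact_mod_cast hj
      linarith
    have hM0 : 0 < R * s := Nat.mul_pos hR1 hs1
    have hi : ⌊x * (R * s : ℕ)⌋₊ ≤ R * s :=
      Nat.floor_le_of_le (mul_le_of_le_one_left (Nat.cast_nonneg _) hx.2)
    rw [hy, hget _ (by omega)]
    refine abs_distRankFun_sub_le_of_grid hρ hχ hM0 ?_ hsq hδ hx.1 (hmem _ hi).2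
    rw [Nat.cast_mul]
    exact mul_le_mul hR3 (sqrt_le_cast hns) (Real.sqrt_nonneg _) (Nat.cast_nonneg _)

/-! ### Approximation of the rank function by chords -/

/-- The point with index `k` is within `τ` of the chord between those with indices `a` and `b`
(after multiplication by the length of the interval spanned by the chord). -/
def ChordTest (X : ℕ → ℝ) (τ a b k : ℕ) : Prop :=
  (X k - X a) * ((b - a : ℕ) : ℝ) ≤ (X b - X a) * ((k - a : ℕ) : ℝ) + (X b - X a) * τ ∧
  (X b - X a) * ((k - a : ℕ) : ℝ) ≤ (X k - X a) * ((b - a : ℕ) : ℝ) + (X b - X a) * τ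

/-- Every `s`-th point between `a` and `b` is within `τ` of the chord. -/
def GoodLink (X : ℕ → ℝ) (n s τ a b : ℕ) : Prop :=
  a ≤ b ∧ b < n ∧ s ∣ a ∧ s ∣ b ∧ ∀ k, a ≤ k → k ≤ b → s ∣ k → ChordTest X τ a b k

/-- The chord from `a` could not be extended beyond `b`. -/
def BadLink (X : ℕ → ℝ) (n s τ a b : ℕ) : Prop :=
  a + s ≤ b ∧ b + s < n ∧ ∃ k, a ≤ k ∧ k ≤ b + s ∧ ¬ ChordTest X τ a (b + s) k

/-- The entries `1, …, e` of a list are successively related. -/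
def Links (p : ℕ → ℕ → Prop) (mem : ℕ → ℕ) (e : ℕ) : Prop :=
  ∀ j, 1 ≤ j → j < e → p (mem j) (mem (j + 1))

theorem Links.update {p : ℕ → ℕ → Prop} {mem : ℕ → ℕ} {e b : ℕ} (h : Links p mem e)
    (hb : p (mem e) b) : Links p (Function.update mem (e + 1) b) (e + 1) := by
  intro j hj hje
  rw [Function.update_of_ne (by omega)]
  rcases Nat.lt_succ_iff_lt_or_eq.1 hje with hlt | rfl
  · rw [Function.update_of_ne (by omega)]
    exact h j hj hlt
  · rwa [Function.update_self]

theorem Links.update_zero {p : ℕ → ℕ → Prop} {mem : ℕ → ℕ} {e b : ℕ} (h : Links p mem e) :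
    Links p (Function.update mem 0 b) e := by
  intro j hj hje
  rw [Function.update_of_ne (by omega), Function.update_of_ne (by omega)]
  exact h j hj hje

/-- Thus no test fails once `τ ≥ n`, which ends the doubling of the tolerance. -/
theorem chordTest_of_le {X : ℕ → ℝ} (hX : Monotone X) {τ a b k : ℕ} (hak : a ≤ k) (hkb : k ≤ b)
    (h : b - a ≤ τ) : ChordTest X τ a b k := by
  have h1 : X a ≤ X k := hX hak
  have h2 : X k ≤ X b := hX hkb
  have h3 : ((b - a : ℕ) : ℝ) ≤ τ := by exact_mod_cast h
  have h4 : ((k - a : ℕ) : ℝ) ≤ ((b - a : ℕ) : ℝ) := by exact_mod_cast Nat.sub_le_sub_right hkb a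
  have h5 : (0 : ℝ) ≤ ((k - a : ℕ) : ℝ) := Nat.cast_nonneg _
  constructor <;> nlinarith

theorem chordTest_left {X : ℕ → ℝ} (hX : Monotone X) {τ a b : ℕ} (hab : a ≤ b) :
    ChordTest X τ a b a := by
  have h : 0 ≤ (X b - X a) * τ := mul_nonneg (sub_nonneg.2 (hX hab)) (Nat.cast_nonneg _)
  constructor <;> simp [h]

theorem chordTest_right {X : ℕ → ℝ} (hX : Monotone X) {τ a b : ℕ} (hab : a ≤ b) :
    ChordTest X τ a b b := by
  have h : 0 ≤ (X b - X a) * τ := mul_nonneg (sub_nonneg.2 (hX hab)) (Nat.cast_nonneg _)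
  constructor <;> linarith

/-- Used in contrapositive form: a failed test certifies that the records increase strictly from `a`
to `b`, in spite of possible ties. -/
theorem chordTest_of_eq {X : ℕ → ℝ} (hX : Monotone X) {τ a b k : ℕ} (hak : a ≤ k) (hkb : k ≤ b)
    (h : X b ≤ X a) : ChordTest X τ a b k := by
  have h1 : X a ≤ X k := hX hak
  have h2 : X k ≤ X b := hX hkb
  rw [ChordTest, show X k = X a by linarith, show X b = X a by linarith]
  simp

theorem chordTest_of_affine {X : ℕ → ℝ} (hX : Monotone X) {τ a b k : ℕ} (hak : a ≤ k)
    (hkb : k ≤ b) {A B δ : ℝ} (hτ : 2 * δ ≤ τ) (ha : |(a : ℝ) - (A * X a + B)| ≤ δ)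
    (hb : |(b : ℝ) - (A * X b + B)| ≤ δ) (hk : |(k : ℝ) - (A * X k + B)| ≤ δ) :
    ChordTest X τ a b k := by
  have h1 : 0 ≤ X k - X a := sub_nonneg.2 (hX hak)
  have h2 : 0 ≤ X b - X k := sub_nonneg.2 (hX hkb)
  have h3 : 0 ≤ X b - X a := by linarith
  rw [ChordTest, Nat.cast_sub hak, Nat.cast_sub (hak.trans hkb)]
  obtain ⟨ea, hea⟩ : ∃ e, e = (a : ℝ) - (A * X a + B) := ⟨_, rfl⟩
  obtain ⟨eb, heb⟩ : ∃ e, e = (b : ℝ) - (A * X b + B) := ⟨_, rfl⟩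
  obtain ⟨ek, hek⟩ : ∃ e, e = (k : ℝ) - (A * X k + B) := ⟨_, rfl⟩
  rw [← hea, abs_le] at ha
  rw [← heb, abs_le] at hb
  rw [← hek, abs_le] at hk
  -- The affine part cancels. What is left is a weighted mean of the end residuals minus the
  -- residual at `k`, scaled by `X b - X a`, hence at most `2 δ (X b - X a)` in absolute value.
  have hdiff : (X k - X a) * ((b : ℝ) - a) - (X b - X a) * ((k : ℝ) - a) =
      eb * (X k - X a) + ea * (X b - X k) - ek * (X b - X a) := by
    rw [hea, heb, hek]; ring
  have g0 : (X b - X a) * (2 * δ) ≤ (X b - X a) * τ := by gcongr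
  have g1 := mul_le_mul_of_nonneg_right hb.1 h1
  have g2 := mul_le_mul_of_nonneg_right hb.2 h1
  have g3 := mul_le_mul_of_nonneg_right ha.1 h2
  have g4 := mul_le_mul_of_nonneg_right ha.2 h2
  have g5 := mul_le_mul_of_nonneg_right hk.1 h3
  have g6 := mul_le_mul_of_nonneg_right hk.2 h3
  constructor <;> nlinarith

section Sorted

variable {n : ℕ} {v : Fin n → ℝ} (hv : Monotone v) (hI : ∀ i, v i ∈ Icc (0 : ℝ) 1)
include hv hI

omit hI in
/-- On an interval where the approximated function is affine it is close to the index of a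
record. -/
theorem abs_sub_affine_le {r : ℝ → ℝ} {δ u w A B : ℝ} (hr : ∀ x, |rankFun v x - r x| ≤ δ)
    (hAB : ∀ x ∈ Ioo u w, r x = A * x + B) (hw : w ≤ 1) {k : ℕ} (hu : u < recordAt v k)
    (hkw : recordAt v k < w) : |(k : ℝ) - (A * recordAt v k + B)| ≤ δ := by
  set x := recordAt v k
  have h1 := abs_le.1 (hr x)
  rw [hAB x ⟨hu, hkw⟩] at h1
  have h2 : rankFun v x ≤ k := rankFun_le_of_le_recordAt hv le_rfl
  rw [abs_le]
  refine ⟨by linarith, ?_⟩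
  -- Because of ties the rank at `x` may be far below `k`. Immediately to the right of `x` the rank
  -- is at least `k + 1`, and the affine bound passes to the limit.
  have hlim : Filter.Tendsto (fun y => A * y + B + δ) (nhdsWithin x (Ioi x))
      (nhds (A * x + B + δ)) :=
    ((by fun_prop : Continuous fun y : ℝ => A * y + B + δ).tendsto x).mono_left nhdsWithin_le_nhds
  have h3 : (k : ℝ) ≤ A * x + B + δ := by
    refine ge_of_tendsto hlim ?_
    filter_upwards [Ioo_mem_nhdsGT hkw] with y hy
    have h4 := lt_rankFun_of_recordAt_lt hv (hy.2.le.trans hw) hy.1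
    have h5 := abs_le.1 (hr y)
    rw [hAB y ⟨hu.trans hy.1, hy.2⟩] at h5
    linarith
  linarith

/-- Without a breakpoint in the closed interval spanned by the chord, all its records lie in one
open affine piece. Their indices are then within `δ` of an affine function and `chordTest_of_affine`
applies. -/
theorem exists_breakpoint_of_not_chordTest {r : ℝ → ℝ} {δ : ℝ} {t : ℕ → ℝ} {l τ a b k : ℕ}
    (hr : ∀ x, |rankFun v x - r x| ≤ δ) (ht : Monotone t) (ht0 : t 0 = 0) (htl : t l = 1)
    (hlin : ∀ i < l, ∃ A B : ℝ, ∀ x ∈ Ioo (t i) (t (i + 1)), r x = A * x + B)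
    (hτ : 2 * δ ≤ τ) (hak : a ≤ k) (hkb : k ≤ b) (h : ¬ ChordTest (recordAt v) τ a b k) :
    ∃ i ≤ l, recordAt v a ≤ t i ∧ t i ≤ recordAt v b := by
  by_contra! hcon
  have hX := recordAt_mono hv hI
  have hex : ∃ m, recordAt v b < t m := by
    refine ⟨l, hcon l le_rfl ?_⟩
    rw [htl]
    exact (recordAt_mem hI a).2
  classical
  obtain ⟨m, hm, hmin⟩ : ∃ m, recordAt v b < t m ∧ ∀ i < m, t i ≤ recordAt v b :=
    ⟨Nat.find hex, Nat.find_spec hex, fun i hi => not_lt.1 (Nat.find_min hex hi)⟩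
  obtain ⟨i, rfl⟩ : ∃ i, m = i + 1 := by
    refine Nat.exists_eq_succ_of_ne_zero ?_
    rintro rfl
    rw [ht0] at hm
    exact absurd hm (recordAt_mem hI b).1.not_gt
  have hil : i < l := by
    by_contra hil
    have h1 := hmin i (Nat.lt_succ_self i)
    have h2 := hcon l le_rfl (by rw [htl]; exact (recordAt_mem hI a).2)
    exact absurd (h2.trans_le (ht (not_lt.1 hil))) h1.not_gt
  have hia : t i < recordAt v a := by
    by_contra hia
    exact absurd (hcon i hil.le (not_lt.1 hia)) (hmin i (Nat.lt_succ_self i)).not_gt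
  obtain ⟨A, B, hAB⟩ := hlin i hil
  have ht1 : t (i + 1) ≤ 1 := htl ▸ ht hil
  have key (j : ℕ) (hj : a ≤ j) (hjb : j ≤ b) := abs_sub_affine_le hv hr hAB ht1
    (hia.trans_le (hX hj)) ((hX hjb).trans_lt hm)
  exact h (chordTest_of_affine hX hak hkb hτ (key a le_rfl (hak.trans hkb))
    (key b (hak.trans hkb) le_rfl) (key k hak hkb))

/-- A greedy approximation by chords of a function that is close to one with `l` affine pieces
needs few chords. -/
theorem lt_two_mul_of_links {r : ℝ → ℝ} {δ : ℝ} {t : ℕ → ℝ} {l s τ : ℕ} {q : ℕ → ℕ}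
    (hr : ∀ x, |rankFun v x - r x| ≤ δ) (ht : Monotone t) (ht0 : t 0 = 0) (htl : t l = 1)
    (hlin : ∀ i < l, ∃ A B : ℝ, ∀ x ∈ Ioo (t i) (t (i + 1)), r x = A * x + B)
    (hq : Links (BadLink (recordAt v) n s τ) q (4 * l + 9)) : (τ : ℝ) < 2 * δ := by
  by_contra! hτ
  have hX := recordAt_mono hv hI
  set N : ℕ → Finset ℕ := fun j =>
    (Finset.range (l + 1)).filter fun i => t i < recordAt v (q j) with hN
  -- Four links pass a new breakpoint. The failure of link `j` puts one in a closed interval that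
  -- ends no later than record `q (j + 2)`; the failure of link `j + 2` excludes ties, so record `q
  -- (j + 4)` lies strictly beyond it.
  have hstep (j : ℕ) (hj : 1 ≤ j) (hj4 : j + 4 ≤ 4 * l + 9) : (N j).card < (N (j + 4)).card := by
    obtain ⟨-, -, k, hk1, hk2, hk⟩ := hq j hj (by omega)
    obtain ⟨h1, -, -⟩ := hq (j + 1) (by omega) (by omega)
    obtain ⟨h2, -, k', hk1', hk2', hk'⟩ := hq (j + 2) (by omega) (by omega)
    obtain ⟨h3, -, -⟩ := hq (j + 3) (by omega) (by omega)
    obtain ⟨i, hil, hi1, hi2⟩ := exists_breakpoint_of_not_chordTest hv hI hr ht ht0 htl hlin hτ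
      hk1 hk2 hk
    have hlt : recordAt v (q (j + 2)) < recordAt v (q (j + 2 + 1) + s) := by
      by_contra hle
      exact hk' (chordTest_of_eq hX hk1' hk2' (not_lt.1 hle))
    have hi4 : t i < recordAt v (q (j + 4)) :=
      (hi2.trans (hX h1)).trans_lt (hlt.trans_le (hX h3))
    refine Finset.card_lt_card ⟨fun x hx => ?_, fun hsub => ?_⟩
    · simp only [hN, Finset.mem_filter] at hx ⊢
      refine ⟨hx.1, hx.2.trans_le (hX ?_)⟩
      obtain ⟨h0, -, -⟩ := hq j hj (by omega)
      have e1 : q (j + 1 + 1) = q (j + 2) := rfl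
      have e2 : q (j + 2 + 1) = q (j + 3) := rfl
      have e3 : q (j + 3 + 1) = q (j + 4) := rfl
      omega
    · have hmem : i ∈ N (j + 4) := by
        simp only [hN, Finset.mem_filter, Finset.mem_range]
        exact ⟨by omega, hi4⟩
      have := hsub hmem
      simp only [hN, Finset.mem_filter] at this
      exact absurd this.2 hi1.not_gt
  have hcount : ∀ m, m ≤ l + 2 → m ≤ (N (4 * m + 1)).card := by
    intro m
    induction m with
    | zero => intro _; exact Nat.zero_le _
    | succ m ih =>
      intro hm
      have h1 := ih (by omega)
      have h2 := hstep (4 * m + 1) (by omega) (by omega)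
      rw [show 4 * (m + 1) + 1 = 4 * m + 1 + 4 by ring]
      omega
  -- Entry `4 (l + 2) + 1 = 4 l + 9` would have passed `l + 2` breakpoints, but there are only `l +
  -- 1`.
  have h1 := hcount (l + 2) le_rfl
  have h2 : (N (4 * (l + 2) + 1)).card ≤ l + 1 :=
    (Finset.card_filter_le _ _).trans (by simp)
  omega

/-- The query lies between two consecutive tested records. The chord is monotone and within `τ` of
the index at both, the rank lies between these indices, and they differ by `s`. -/
theorem abs_chord_sub_rankFun_le {s τ a b : ℕ} (h : GoodLink (recordAt v) n s τ a b) {x : ℝ}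
    (hx : x ≤ 1) (hax : recordAt v a < x) (hxb : x ≤ recordAt v b) :
    |(a + ((b - a : ℕ) : ℝ) * ((x - recordAt v a) / (recordAt v b - recordAt v a))) - rankFun v x|
      ≤ τ + s := by
  obtain ⟨hab, hbn, hsa, hsb, htest⟩ := h
  have hX := recordAt_mono hv hI
  set X := recordAt v
  have hD : 0 < X b - X a := by linarith
  have hs : 0 < s := by
    rcases Nat.eq_zero_or_pos s with rfl | hs
    · rw [zero_dvd_iff] at hsa hsb
      rw [hsa, hsb] at hD
      simp at hD
    · exact hs
  obtain ⟨m, hm⟩ : ∃ m, b = a + s * m := by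
    obtain ⟨c, hc⟩ := (Nat.dvd_sub hsb hsa)
    exact ⟨c, by omega⟩
  have hex : ∃ m, x ≤ X (a + s * m) := ⟨m, hm ▸ hxb⟩
  classical
  obtain ⟨i, hi, hmin⟩ : ∃ i, x ≤ X (a + s * i) ∧ ∀ j < i, X (a + s * j) < x :=
    ⟨Nat.find hex, Nat.find_spec hex, fun i hi => not_le.1 (Nat.find_min hex hi)⟩
  have him : i ≤ m := by
    by_contra him
    exact absurd hxb (hm ▸ hmin m (not_le.1 him)).not_ge
  obtain ⟨i, rfl⟩ : ∃ j, i = j + 1 := by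
    refine Nat.exists_eq_succ_of_ne_zero ?_
    rintro rfl
    exact absurd hax (by simpa using hi)
  have hlo := hmin i (Nat.lt_succ_self i)
  have hle : s * (i + 1) ≤ s * m := Nat.mul_le_mul_left _ him
  rw [mul_add, mul_one] at hle hi
  have ht1 := (htest (a + s * i) (by omega) (by omega) (Dvd.dvd.add hsa ⟨i, rfl⟩)).2
  have ht2 := (htest (a + (s * i + s)) (by omega) (by omega)
    (Dvd.dvd.add hsa ((Dvd.intro i rfl).add dvd_rfl))).1
  have hr1 := rankFun_le_of_le_recordAt hv hi
  have hr2 := lt_rankFun_of_recordAt_lt hv hx hlo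
  rw [Nat.add_sub_cancel_left] at ht1 ht2
  have hba : (0 : ℝ) ≤ ((b - a : ℕ) : ℝ) := Nat.cast_nonneg _
  have h1 : ((s * i : ℕ) : ℝ) - τ ≤ ((b - a : ℕ) : ℝ) * ((x - X a) / (X b - X a)) := by
    rw [← mul_div_assoc, le_div_iff₀ hD]
    have : (X (a + s * i) - X a) * ((b - a : ℕ) : ℝ) ≤ (x - X a) * ((b - a : ℕ) : ℝ) := by
      gcongr
    linarith
  have h2 : ((b - a : ℕ) : ℝ) * ((x - X a) / (X b - X a)) ≤ ((s * i + s : ℕ) : ℝ) + τ := by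
    rw [← mul_div_assoc, div_le_iff₀ hD]
    have : (x - X a) * ((b - a : ℕ) : ℝ) ≤ (X (a + (s * i + s)) - X a) * ((b - a : ℕ) : ℝ) := by
      gcongr
    linarith
  push_cast at *
  rw [abs_le]
  constructor <;> linarith

end Sorted

/-! ### The greedy chord algorithm -/

/-- Greedy approximation of the rank function by chords with tolerance `τ`, which starts with
`⌈√n⌉` and is doubled whenever more than `K` breakpoints are found.  The model consists of the
number `e` of breakpoints and their indices. -/
def chordTraining (K : ℕ) : Program := sqrtProgram ++
  [.natAdd 4 3 0, .natConst 5 K,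
   .natConst 6 0, .natAdd 7 3 0, .natConst 8 0, .natConst 9 1, .natStore 9 6,
   .jumpNatLt 7 1 16, .jump 46,
   .jumpNatLt 8 7 20, .natAdd 7 7 3, .natAdd 8 6 0, .jump 14,
   .realData 0 6, .realData 1 7, .realData 2 8, .realSub 1 1 0, .realSub 2 2 0,
   .natSub 10 7 6, .realOfNat 3 10, .realMul 2 2 3,
   .natSub 10 8 6, .realOfNat 3 10, .realMul 3 1 3,
   .realOfNat 4 4, .realMul 4 1 4,
   .realAdd 5 3 4, .jumpRealLt 5 2 39, .realAdd 5 2 4, .jumpRealLt 5 3 39,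
   .natAdd 8 8 3, .jump 16,
   .natSub 6 7 3, .natAdd 8 6 0, .natAdd 9 9 2, .natStore 9 6, .jumpNatLt 9 5 16,
   .natAdd 4 4 4, .jump 9,
   .natSub 6 7 3, .natAdd 9 9 2, .natStore 9 6, .natStore 0 9, .natAdd 0 9 2, .halt]

/-- The tolerance `τ` is minimal up to a factor `2`. -/
def MinimalTolerance (X : ℕ → ℝ) (n s K τ : ℕ) : Prop :=
  τ = s ∨ ∃ τ' q, τ = τ' + τ' ∧ Links (BadLink X n s τ') q K

/-- The result of the greedy chord algorithm. -/
def ChordModel (X : ℕ → ℝ) (n K s : ℕ) (L : ℕ) (mem : ℕ → ℕ) : Prop :=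
  ∃ τ e, MinimalTolerance X n s K τ ∧ 2 ≤ e ∧ e ≤ K ∧ L = e + 1 ∧ mem 0 = e ∧ mem 1 = 0 ∧
    mem e < n ∧ n ≤ mem e + s ∧ (∀ j, 1 ≤ j → j ≤ e → mem j ≤ mem e) ∧
    Links (GoodLink X n s τ) mem e

section Training

variable {n K s W : ℕ} {v : Fin n → ℝ}

/-- Registers `3` to `9` hold the step `s`, the tolerance, `K`, the start `a` of the current chord,
its tentative end `b`, the tested index `k` and the number `e` of breakpoints. When `b` leaves the
dataset, the verified chord to `b - s` becomes the last link. -/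
theorem chordTraining_finish {τ a k b e z : ℕ} {r : List ℝ} {mem : ℕ → ℕ}
    {Q : Config → Prop}
    (hQ : ∀ c : Config, ChordModel (recordAt v) n K s (c.nat 0) c.mem → Q c)
    (hKW : K + 1 ≤ W) (hnW : 4 * n ≤ W) (hsb : s ≤ b) (hnb : n ≤ b) (hbn : b < n + s)
    (he : 1 ≤ e) (heK : e < K) (hτ : MinimalTolerance (recordAt v) n s K τ)
    (hm1 : mem 1 = 0) (hme : mem e = a)
    (hlinks : Links (GoodLink (recordAt v) n s τ) mem e)
    (hlast : GoodLink (recordAt v) n s τ a (b - s)) :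
    (chordTraining K).HaltsWithin W v
      ⟨14, regs [0, n, 1, s, τ, K, a, b, k, e, z], regs r, mem⟩ 7 Q := by
  refine .jumpNatLt_neg rfl (show ¬ b < n by omega) ?_
  refine .jump rfl ?_
  refine .natSub rfl rfl (show b - s ≤ W by omega) ?_
  refine .natAdd rfl rfl (show e + 1 ≤ W by omega) ?_
  refine .natStore rfl ?_
  refine .natStore rfl ?_
  refine .natAdd rfl rfl (show e + 1 + 1 ≤ W by omega) ?_
  refine .halt rfl (hQ _ ?_)
  change ChordModel (recordAt v) n K s (e + 2)
    (Function.update (Function.update mem (e + 1) (b - s)) 0 (e + 1))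
  have hl := hlinks.update (hme.symm ▸ hlast)
  have hend : Function.update (Function.update mem (e + 1) (b - s)) 0 (e + 1) (e + 1) = b - s := by
    rw [Function.update_of_ne (by omega), Function.update_self]
  have hl' : Links (GoodLink (recordAt v) n s τ)
      (Function.update (Function.update mem (e + 1) (b - s)) 0 (e + 1)) (e + 1) :=
    hl.update_zero
  refine ⟨τ, e + 1, hτ, by omega, by omega, rfl, Function.update_self .., ?_, ?_, ?_, ?_, hl'⟩
  · rw [Function.update_of_ne (by omega), Function.update_of_ne (by omega), hm1]
  · rw [hend]; omega
  · rw [hend]; omega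
  · have hdec : ∀ i j, 1 ≤ j → j + i = e + 1 →
        Function.update (Function.update mem (e + 1) (b - s)) 0 (e + 1) j ≤
          Function.update (Function.update mem (e + 1) (b - s)) 0 (e + 1) (e + 1) := by
      intro i
      induction i with
      | zero => rintro j - rfl; exact le_rfl
      | succ i ih =>
        intro j hj hji
        exact (hl' j hj (by omega)).1.trans (ih (j + 1) (by omega) (by omega))
    exact fun j hj hje => hdec (e + 1 - j) j hj (by omega)

theorem goodLink_self (hX : Monotone (recordAt v)) {τ a : ℕ} (ha : a < n) (hsa : s ∣ a) :
    GoodLink (recordAt v) n s τ a a :=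
  ⟨le_rfl, ha, hsa, hsa, fun _ h1 h2 _ => chordTest_of_eq hX h1 h2 le_rfl⟩

theorem links_one {p : ℕ → ℕ → Prop} {mem : ℕ → ℕ} : Links p mem 1 :=
  fun _ hj hj' => absurd hj' hj.not_gt

/-- Start of a round with a new tolerance. If `s ≥ n`, index `0` is the only one sampled and the
model is a degenerate chord. -/
theorem chordTraining_start {τ a b k e z m : ℕ} {r : List ℝ} {mem : ℕ → ℕ}
    {Q : Config → Prop} (hX : Monotone (recordAt v)) (hn : 1 ≤ n)
    (hQ : ∀ c : Config, ChordModel (recordAt v) n K s (c.nat 0) c.mem → Q c)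
    (hK : 2 ≤ K) (hKW : K + 1 ≤ W) (hnW : 4 * n ≤ W) (hs : 1 ≤ s) (hs2 : s ≤ 2 * n)
    (hτ : MinimalTolerance (recordAt v) n s K τ)
    (H : s < n → (chordTraining K).HaltsWithin W v
      ⟨16, regs [0, n, 1, s, τ, K, 0, s, 0, 1, z], regs r, Function.update mem 1 0⟩ m Q) :
    (chordTraining K).HaltsWithin W v
      ⟨9, regs [0, n, 1, s, τ, K, a, b, k, e, z], regs r, mem⟩ (m + 12) Q := by
  refine .natConst rfl rfl (Nat.zero_le W) ?_
  refine .natAdd rfl rfl (show s + 0 ≤ W by omega) ?_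
  refine .natConst rfl rfl (Nat.zero_le W) ?_
  refine .natConst rfl rfl (show 1 ≤ W by omega) ?_
  refine .natStore rfl ?_
  by_cases hsn : s < n
  · refine .jumpNatLt_pos rfl (show s < n from hsn) ?_
    exact .mono (H hsn) (by omega)
  · refine .mono (k := 7) ?_ (by omega)
    change (chordTraining K).HaltsWithin W v
      ⟨14, regs [0, n, 1, s, τ, K, 0, s, 0, 1, z], regs r, Function.update mem 1 0⟩ 7 Q
    refine chordTraining_finish hQ hKW hnW le_rfl (not_lt.1 hsn) (by omega) le_rfl (by omega)
      hτ (Function.update_self ..) (Function.update_self ..) links_one ?_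
    rw [Nat.sub_self]
    exact goodLink_self hX hn (dvd_zero s)

theorem chordTraining_check {τ a b k e z m : ℕ} {x₀ x₁ x₂ x₃ x₄ x₅ : ℝ} {mem : ℕ → ℕ}
    {Q : Config → Prop} (hnW : 4 * n ≤ W) (hak : a ≤ k) (hkb : k < b) (hbn : b < n)
    (hpass : ChordTest (recordAt v) τ a b k → ∀ y₀ y₁ y₂ y₃ y₄ y₅ z,
      (chordTraining K).HaltsWithin W v ⟨37, regs [0, n, 1, s, τ, K, a, b, k, e, z],
        regs [y₀, y₁, y₂, y₃, y₄, y₅], mem⟩ m Q)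
    (hfail : ¬ ChordTest (recordAt v) τ a b k → ∀ y₀ y₁ y₂ y₃ y₄ y₅ z,
      (chordTraining K).HaltsWithin W v ⟨39, regs [0, n, 1, s, τ, K, a, b, k, e, z],
        regs [y₀, y₁, y₂, y₃, y₄, y₅], mem⟩ m Q) :
    (chordTraining K).HaltsWithin W v ⟨16, regs [0, n, 1, s, τ, K, a, b, k, e, z],
      regs [x₀, x₁, x₂, x₃, x₄, x₅], mem⟩ (m + 18) Q := by
  have han : a < n := by omega
  have hkn : k < n := by omega
  rw [ChordTest, recordAt_of_lt v han, recordAt_of_lt v hbn, recordAt_of_lt v hkn] at hpass hfail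
  generalize hxa : v ⟨a, han⟩ = xa at *
  generalize hxb : v ⟨b, hbn⟩ = xb at *
  generalize hxk : v ⟨k, hkn⟩ = xk at *
  refine .jumpNatLt_pos rfl hkb ?_
  refine .realData rfl rfl han ?_
  refine .realData rfl rfl hbn ?_
  refine .realData rfl rfl hkn ?_
  change (chordTraining K).HaltsWithin W v ⟨23, regs [0, n, 1, s, τ, K, a, b, k, e, z],
      regs [v ⟨a, han⟩, v ⟨b, hbn⟩, v ⟨k, hkn⟩, x₃, x₄, x₅], mem⟩ _ Q
  rw [hxa, hxb, hxk]
  refine .realSub rfl rfl ?_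
  refine .realSub rfl rfl ?_
  refine .natSub rfl rfl (show b - a ≤ W by omega) ?_
  refine .realOfNat rfl rfl ?_
  refine .realMul rfl rfl ?_
  refine .natSub rfl rfl (show k - a ≤ W by omega) ?_
  refine .realOfNat rfl rfl ?_
  refine .realMul rfl rfl ?_
  refine .realOfNat rfl rfl ?_
  refine .realMul rfl rfl ?_
  change (chordTraining K).HaltsWithin W v ⟨33, regs [0, n, 1, s, τ, K, a, b, k, e, k - a],
      regs [xa, xb - xa, (xk - xa) * ((b - a : ℕ) : ℝ), (xb - xa) * ((k - a : ℕ) : ℝ),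
        (xb - xa) * τ, x₅], mem⟩ _ Q
  generalize (xk - xa) * ((b - a : ℕ) : ℝ) = lhs at *
  generalize (xb - xa) * ((k - a : ℕ) : ℝ) = rhs at *
  generalize (xb - xa) * (τ : ℝ) = tol at *
  refine .realAdd rfl rfl ?_
  by_cases h1 : rhs + tol < lhs
  · refine .jumpRealLt_pos rfl h1 ?_
    exact .mono (hfail (fun h => absurd h.1 h1.not_ge) _ _ _ _ _ _ _) (by omega)
  refine .jumpRealLt_neg rfl h1 ?_
  refine .realAdd rfl rfl ?_
  by_cases h2 : lhs + tol < rhs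
  · refine .jumpRealLt_pos rfl h2 ?_
    exact .mono (hfail (fun h => absurd h.2 h2.not_ge) _ _ _ _ _ _ _) (by omega)
  refine .jumpRealLt_neg rfl h2 ?_
  exact hpass ⟨not_lt.1 h1, not_lt.1 h2⟩ _ _ _ _ _ _ _

/-- The number of iterations of the main loop for one tolerance, from indices `s a`, `s b`, `s k`. -/
def roundFuel (s a b k : ℕ) : ℕ :=
  (s + 1 - b) * (2 * s + 6) + (if a + 1 < b then s + 3 else 0) + (b - k)

theorem roundFuel_step {s a b k : ℕ} (h : k < b) :
    roundFuel s a b (k + 1) < roundFuel s a b k := by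
  simp only [roundFuel]
  omega

/-- Advancing `b` releases `2 s + 6`, enough for a new scan of at most `s` points and a reserve of
`s + 3` for a restart. -/
theorem roundFuel_extend {s a b : ℕ} (hab : a < b) (hb : b < s) :
    roundFuel s a (b + 1) a < roundFuel s a b b := by
  simp only [roundFuel]
  rw [show s + 1 - b = (s + 1 - (b + 1)) + 1 by omega, Nat.succ_mul _ (2 * s + 6)]
  generalize (s + 1 - (b + 1)) * (2 * s + 6) = c
  split_ifs <;> omega

/-- A restart consumes the reserve. It happens at most once for each `b`, since afterwards the chord
spans a single step and cannot fail. -/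
theorem roundFuel_restart {s a b k : ℕ} (hab : a + 1 < b) (hb : b < s) :
    roundFuel s (b - 1) b (b - 1) < roundFuel s a b k ∧ 0 < roundFuel s a b k := by
  simp only [roundFuel]
  rw [if_neg (by omega), if_pos hab]
  omega

/-- Induction on the fuel left in this round plus `R` full rounds. The condition `n ≤ τ * 2 ^ R`
makes `R` a bound for the doublings to come. All stored links are both good, for accuracy, and bad,
as evidence against `τ` should `K` entries be reached. -/
theorem chordTraining_loop {Q : Config → Prop} (hv : Monotone v) (hI : ∀ i, v i ∈ Icc (0 : ℝ) 1)
    (hQ : ∀ c : Config, ChordModel (recordAt v) n K s (c.nat 0) c.mem → Q c)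
    (hs : 1 ≤ s) (hns : n ≤ s * s) (hs2 : s ≤ 2 * n) (hK : 2 ≤ K)
    (hKW : K + 1 ≤ W) (hnW : 4 * n ≤ W) :
    ∀ f R τ a b k e z x₀ x₁ x₂ x₃ x₄ x₅ mem, a ≤ k → k ≤ b → a < b → s * b < n → 1 ≤ e → e < K →
      mem 1 = 0 → mem e = s * a → MinimalTolerance (recordAt v) n s K τ →
      τ ≤ W →
      Links (GoodLink (recordAt v) n s τ) mem e → Links (BadLink (recordAt v) n s τ) mem e →
      GoodLink (recordAt v) n s τ (s * a) (s * (b - 1)) →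
      (∀ i, a ≤ i → i < k → ChordTest (recordAt v) τ (s * a) (s * b) (s * i)) →
      n ≤ τ * 2 ^ R → roundFuel s a b k + R * roundFuel s 0 1 0 ≤ f →
      (chordTraining K).HaltsWithin W v
        ⟨16, regs [0, n, 1, s, τ, K, s * a, s * b, s * k, e, z], regs [x₀, x₁, x₂, x₃, x₄, x₅], mem⟩
        (40 * f + 40) Q := by
  have hX := recordAt_mono hv hI
  intro f
  induction f with
  | zero =>
    intro R τ a b k e z x₀ x₁ x₂ x₃ x₄ x₅ mem hak hkb hab hbn he heK hm1 hme hmin hτW hgood hbad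
      hlast htest hR hf
    exfalso
    have hbs : b < s := lt_of_mul_lt_mul_left (hbn.trans_le hns) (Nat.zero_le s)
    have : 0 < (s + 1 - b) * (2 * s + 6) := Nat.mul_pos (by omega) (by omega)
    simp only [roundFuel] at hf
    omega
  | succ f ih =>
    intro R τ a b k e z x₀ x₁ x₂ x₃ x₄ x₅ mem hak hkb hab hbn he heK hm1 hme hmin hτW hgood hbad
      hlast htest hR hf
    have hbs : b < s := lt_of_mul_lt_mul_left (hbn.trans_le hns) (Nat.zero_le s)
    have hka : s * a ≤ s * k := Nat.mul_le_mul_left _ hak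
    have hkb' : s * k ≤ s * b := Nat.mul_le_mul_left _ hkb
    have hsb : s * (b - 1) + s = s * b := by
      rw [← Nat.mul_succ]; congr 1; omega
    have ha' : s * a ≤ s * (b - 1) := Nat.mul_le_mul_left _ (by omega)
    rw [show 40 * (f + 1) + 40 = 40 * f + 80 by ring]
    rcases Nat.lt_or_ge k b with hlt | hge
    · -- check the point with index `s k`
      have hlt' : s * k < s * b := Nat.mul_lt_mul_of_pos_left hlt hs
      have han : s * a < n := by omega
      have hkn : s * k < n := by omega
      have fail (y₀ y₁ y₂ y₃ y₄ y₅ : ℝ) (z : ℕ)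
          (hnot : ¬ ChordTest (recordAt v) τ (s * a) (s * b) (s * k)) :
          (chordTraining K).HaltsWithin W v
            ⟨39, regs [0, n, 1, s, τ, K, s * a, s * b, s * k, e, z],
              regs [y₀, y₁, y₂, y₃, y₄, y₅], mem⟩ (40 * f + 60) Q := by
        -- The chord passes at its own endpoints, so a failure leaves an interior point and the link
        -- to `b - 1` advances by at least one step.
        have hak' : a < k := by
          rcases hak.lt_or_eq with h | rfl
          · exact h
          · exact absurd (chordTest_left hX (by omega)) hnot
        have hbadlast : BadLink (recordAt v) n s τ (s * a) (s * b - s) := by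
          refine ⟨?_, by omega, s * k, hka, by omega, ?_⟩
          · have := Nat.mul_le_mul_left s (show a + 1 ≤ b - 1 by omega)
            rw [Nat.mul_succ] at this
            omega
          · rwa [Nat.sub_add_cancel (by omega)]
        have hgoodlast : GoodLink (recordAt v) n s τ (s * a) (s * b - s) := by
          rwa [← hsb, Nat.add_sub_cancel]
        have hgood' := hgood.update (hme.symm ▸ hgoodlast)
        have hbad' := hbad.update (hme.symm ▸ hbadlast)
        have hme' : Function.update mem (e + 1) (s * b - s) (e + 1) = s * (b - 1) := by
          rw [Function.update_self]; omega
        have hm1' : Function.update mem (e + 1) (s * b - s) 1 = 0 := by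
          rw [Function.update_of_ne (by omega), hm1]
        have hfuel := roundFuel_restart (k := k) (show a + 1 < b by omega) hbs
        refine .mono (k := 40 * f + 56 + 1 + 1 + 1 + 1) ?_ (by omega)
        refine .natSub rfl rfl (show s * b - s ≤ W by omega) ?_
        refine .natAdd rfl rfl (show s * b - s + 0 ≤ W by omega) ?_
        refine .natAdd rfl rfl (show e + 1 ≤ W by omega) ?_
        refine .natStore rfl ?_
        change (chordTraining K).HaltsWithin W v
          ⟨43, regs [0, n, 1, s, τ, K, s * b - s, s * b, s * b - s, e + 1, z],
            regs [y₀, y₁, y₂, y₃, y₄, y₅], Function.update mem (e + 1) (s * b - s)⟩ _ Q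
        generalize Function.update mem (e + 1) (s * b - s) = mem' at *
        rw [show s * b - s = s * (b - 1) by omega]
        by_cases heK' : e + 1 < K
        · refine .jumpNatLt_pos rfl heK' ?_
          refine .mono (ih R τ (b - 1) b (b - 1) (e + 1) z y₀ y₁ y₂ y₃ y₄ y₅ mem' le_rfl (by omega)
            (by omega) hbn (by omega) heK' hm1' hme' hmin hτW hgood' hbad' ?_ ?_ hR (by omega))
            (by omega)
          · exact goodLink_self hX (by omega) ⟨_, rfl⟩
          · intro i hi hi'
            omega
        · have hτn : τ < n := by
            by_contra h
            exact hnot (chordTest_of_le hX hka hkb' (by omega))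
          have hR1 : 1 ≤ R := by
            by_contra h
            obtain rfl : R = 0 := by omega
            omega
          obtain ⟨R, rfl⟩ : ∃ R', R = R' + 1 := ⟨R - 1, by omega⟩
          -- The full list of rejected links is the witness that `τ` was too small.
          have hmin' : MinimalTolerance (recordAt v) n s K (τ + τ) := by
            obtain rfl : K = e + 1 := by omega
            exact .inr ⟨τ, mem', rfl, hbad'⟩
          refine .jumpNatLt_neg rfl heK' ?_
          refine .natAdd rfl rfl (show τ + τ ≤ W by omega) ?_
          refine .jump rfl ?_
          refine .mono (chordTraining_start (m := 40 * f + 40) hX (by omega) hQ hK hKW hnW hs hs2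
            hmin' fun hsn => ?_) (by omega)
          have := ih R (τ + τ) 0 1 0 1 z y₀ y₁ y₂ y₃ y₄ y₅ (Function.update mem' 1 0) le_rfl
            (by omega) (by omega) (by omega) le_rfl (by omega) (Function.update_self ..)
            (Function.update_self ..) hmin' (by omega) links_one links_one
            (goodLink_self hX (by omega) ⟨0, rfl⟩)
            (fun i _ hi => absurd hi (Nat.not_lt_zero i))
            (by rw [pow_succ] at hR; linarith) (by rw [Nat.succ_mul] at hf; omega)
          rwa [mul_one, mul_zero] at this
      refine .mono (chordTraining_check (m := 40 * f + 60) hnW hka hlt' hbn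
        (fun hpass y₀ y₁ y₂ y₃ y₄ y₅ z => ?_)
        fun hnot y₀ y₁ y₂ y₃ y₄ y₅ z => fail y₀ y₁ y₂ y₃ y₄ y₅ z hnot) (by omega)
      refine .mono (k := 40 * f + 40 + 1 + 1) ?_ (by omega)
      refine .natAdd rfl rfl (show s * k + s ≤ W by omega) ?_
      have hstep := roundFuel_step (s := s) (a := a) hlt
      exact .jump rfl (ih R τ a b (k + 1) e z y₀ y₁ y₂ y₃ y₄ y₅ mem (by omega) hlt hab hbn he heK
        hm1 hme hmin hτW hgood hbad hlast (fun i hi hi' => by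
          rcases Nat.lt_succ_iff_lt_or_eq.1 hi' with h | rfl
          · exact htest i hi h
          · exact hpass) hR (by omega))
    · -- the chord to `s b` has been verified
      obtain rfl : k = b := le_antisymm hkb hge
      have hgoodb : GoodLink (recordAt v) n s τ (s * a) (s * k) := by
        refine ⟨hka, hbn, ⟨_, rfl⟩, ⟨_, rfl⟩, ?_⟩
        rintro _ h1 h2 ⟨i, rfl⟩
        have h1' := Nat.le_of_mul_le_mul_left h1 hs
        rcases (Nat.le_of_mul_le_mul_left h2 hs).lt_or_eq with h | rfl
        · exact htest i h1' h
        · exact chordTest_right hX hka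
      refine .mono (k := 40 * f + 70 + 1 + 1 + 1 + 1) ?_ (by omega)
      refine .jumpNatLt_neg rfl (lt_irrefl (s * k)) ?_
      refine .natAdd rfl rfl (show s * k + s ≤ W by omega) ?_
      refine .natAdd rfl rfl (show s * a + 0 ≤ W by omega) ?_
      refine .jump rfl ?_
      by_cases hbn' : s * k + s < n
      · refine .mono (k := 40 * f + 40 + 1) ?_ (by omega)
        refine .jumpNatLt_pos rfl hbn' ?_
        have hext := roundFuel_extend hab hbs
        exact ih R τ a (k + 1) a e _ _ _ _ _ _ _ mem le_rfl (by omega) (by omega) hbn' he heK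
          hm1 hme hmin hτW hgood hbad hgoodb (fun i hi hi' => by omega) hR (by omega)
      · change (chordTraining K).HaltsWithin W v ⟨14, regs [0, n, 1, s, τ, K, s * a, s * k + s, s * a,
          e, z], regs [x₀, x₁, x₂, x₃, x₄, x₅], mem⟩ _ Q
        refine .mono (chordTraining_finish hQ hKW hnW (Nat.le_add_left s (s * k)) (by omega)
          (by omega) he heK hmin hm1 hme hgood ?_) (by omega)
        rwa [Nat.add_sub_cancel]

theorem chordTraining_halts (hn : 1 ≤ n) (hv : Monotone v) (hI : ∀ i, v i ∈ Icc (0 : ℝ) 1)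
    (hK : 2 ≤ K) (hKW : K + 1 ≤ W) (hnW : 4 * n ≤ W) :
    (chordTraining K).HaltsWithin W v ⟨0, fun _ => 0, fun _ => 0, fun _ => 0⟩
      (40 * (roundFuel (n.sqrt + 1) 0 1 0 * (Nat.log 2 n + 3)) + 4 * (n.sqrt + 1) + 60)
      fun c => ∃ s, 1 ≤ s ∧ n ≤ s * s ∧ (s - 1) * (s - 1) < n ∧
        ChordModel (recordAt v) n K s (c.nat 0) c.mem := by
  rw [regs_zero 11, regs_zero (α := ℝ) 6]
  set F := roundFuel (n.sqrt + 1) 0 1 0 * (Nat.log 2 n + 3) with hF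
  rw [show 40 * F + 4 * (n.sqrt + 1) + 60 =
    (40 * F + 41 + 12 + 1 + 1) + 4 * (n.sqrt + 1) + 5 by ring]
  refine sqrtProgram_append_halts hn (by omega) fun s hs1 hs2 hns hsn => ?_
  have hs : s ≤ 2 * n := by have := Nat.sqrt_le_self n; omega
  have hX := recordAt_mono hv hI
  have hQ : ∀ c : Config, ChordModel (recordAt v) n K s (c.nat 0) c.mem →
      ∃ s, 1 ≤ s ∧ n ≤ s * s ∧ (s - 1) * (s - 1) < n ∧
        ChordModel (recordAt v) n K s (c.nat 0) c.mem := fun c hc => ⟨s, hs1, hns, hsn, hc⟩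
  refine .natAdd rfl rfl (show s + 0 ≤ W by omega) ?_
  refine .natConst rfl rfl (show K ≤ W by omega) ?_
  have hmin : MinimalTolerance (recordAt v) n s K s := .inl rfl
  refine .mono (chordTraining_start (m := 40 * F + 40) hX hn hQ hK hKW hnW hs1 hs hmin
    fun hsn' => ?_) (by omega)
  have hR : n ≤ s * 2 ^ (Nat.log 2 n + 2) := by
    have := (Nat.lt_pow_succ_log_self (b := 2) (by norm_num) n).le
    calc n ≤ 2 ^ (Nat.log 2 n + 1) := this
      _ ≤ 2 ^ (Nat.log 2 n + 2) := Nat.pow_le_pow_right (by norm_num) (by omega)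
      _ ≤ _ := Nat.le_mul_of_pos_left _ hs1
  have hfuel : roundFuel s 0 1 0 + (Nat.log 2 n + 2) * roundFuel s 0 1 0 ≤ F := by
    have : roundFuel s 0 1 0 ≤ roundFuel (n.sqrt + 1) 0 1 0 := by
      simp only [roundFuel, zero_add, lt_irrefl, if_false]
      gcongr
    rw [hF]
    nlinarith
  have := chordTraining_loop hv hI hQ hs1 hns hs hK hKW hnW F (Nat.log 2 n + 2) s 0 1 0 1 0
    0 0 0 0 0 0 (Function.update (regs (List.replicate 11 0)) 1 0) le_rfl (by omega) (by omega) (by omega) le_rfl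
    (by omega) (Function.update_self ..) (Function.update_self ..) hmin (by omega) links_one
    links_one (goodLink_self hX (by omega) ⟨0, rfl⟩)
    (fun i _ hi => absurd hi (Nat.not_lt_zero i)) hR hfuel
  rw [mul_one, mul_zero] at this
  exact this

end Training

/-! ### Evaluation of a chord model -/

/-- Finds the chord over the query by binary search and evaluates it. -/
def chordEvaluation : Program :=
  [.natConst 1 1, .natLoad 2 0, .natConst 3 2, .natLoad 4 1, .realData 1 4, .jumpRealLt 1 0 8,
   .realConst 0 0, .halt,
   .natLoad 5 2, .realData 2 5, .jumpRealLt 2 0 35,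
   .natSub 6 2 1, .jumpNatLt 6 3 22, .natAdd 7 1 2, .natDiv 7 7 3, .natLoad 8 7, .realData 3 8,
   .jumpRealLt 3 0 20, .natAdd 2 7 0, .jump 11, .natAdd 1 7 0, .jump 11,
   .natLoad 4 1, .natLoad 5 2, .realData 1 4, .realData 2 5, .realSub 2 2 1, .realSub 3 0 1,
   .realDiv 3 3 2, .natSub 6 5 4, .realOfNat 2 6, .realMul 3 2 3, .realOfNat 2 4, .realAdd 0 2 3,
   .halt,
   .realOfNat 0 5, .halt]

/-- The value of a chord model with breakpoints `mem 1, …, mem e` at `x`. -/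
def ChordValue (X : ℕ → ℝ) (mem : ℕ → ℕ) (e : ℕ) (x y : ℝ) : Prop :=
  (x ≤ X (mem 1) ∧ y = 0) ∨ (X (mem e) < x ∧ y = mem e) ∨
    ∃ j, 1 ≤ j ∧ j < e ∧ X (mem j) < x ∧ x ≤ X (mem (j + 1)) ∧
      y = mem j + ((mem (j + 1) - mem j : ℕ) : ℝ) *
        ((x - X (mem j)) / (X (mem (j + 1)) - X (mem j)))

section Evaluation

variable {n W e : ℕ} {v : Fin n → ℝ} {x : ℝ} {mem : ℕ → ℕ}

/-- Halving keeps `hi - lo ≤ 2 ^ f` and record `mem lo` strictly below `x`; the strictness makes the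
denominator of the final chord nonzero in spite of ties. -/
theorem chordEvaluation_loop (hnW : 4 * n ≤ W) (heW : e + e ≤ W)
    (hmem : ∀ j, 1 ≤ j → j ≤ e → mem j < n) :
    ∀ f lo hi r₄ r₅ r₆ r₇ r₈ y₁ y₂ y₃, 1 ≤ lo → lo < hi → hi ≤ e → hi ≤ lo + 2 ^ f →
      recordAt v (mem lo) < x → x ≤ recordAt v (mem hi) →
      chordEvaluation.HaltsWithin W v
        ⟨11, regs [0, lo, hi, 2, r₄, r₅, r₆, r₇, r₈], regs [x, y₁, y₂, y₃], mem⟩ (9 * f + 14)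
        fun c => ChordValue (recordAt v) mem e x (c.real 0) := by
  intro f
  induction f with
  | zero =>
    intro lo hi r₄ r₅ r₆ r₇ r₈ y₁ y₂ y₃ hlo hlt hhi hf hxlo hxhi
    obtain rfl : hi = lo + 1 := by rw [pow_zero] at hf; omega
    have hn1 := hmem lo hlo (by omega)
    have hn2 := hmem (lo + 1) (by omega) hhi
    have hlo' := recordAt_of_lt v hn1
    have hhi' := recordAt_of_lt v hn2
    refine .natSub rfl rfl (show lo + 1 - lo ≤ W by omega) ?_
    refine .jumpNatLt_pos rfl (show lo + 1 - lo < 2 by omega) ?_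
    refine .natLoad rfl rfl (show mem lo ≤ W by omega) ?_
    refine .natLoad rfl rfl (show mem (lo + 1) ≤ W by omega) ?_
    refine .realData rfl rfl hn1 ?_
    refine .realData rfl rfl hn2 ?_
    refine .realSub rfl rfl ?_
    refine .realSub rfl rfl ?_
    refine .realDiv rfl rfl (show v ⟨mem (lo + 1), hn2⟩ - v ⟨mem lo, hn1⟩ ≠ 0 from ?_) ?_
    · rw [← hlo', ← hhi']
      linarith
    refine .natSub rfl rfl (show mem (lo + 1) - mem lo ≤ W by omega) ?_
    refine .realOfNat rfl rfl ?_
    refine .realMul rfl rfl ?_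
    refine .realOfNat rfl rfl ?_
    refine .realAdd rfl rfl ?_
    refine .halt rfl (.inr (.inr ⟨lo, hlo, by omega, hxlo, hxhi, ?_⟩))
    rw [hlo', hhi']
    rfl
  | succ f ih =>
    intro lo hi r₄ r₅ r₆ r₇ r₈ y₁ y₂ y₃ hlo hlt hhi hf hxlo hxhi
    by_cases hd : hi - lo < 2
    · exact .mono (ih lo hi r₄ r₅ r₆ r₇ r₈ y₁ y₂ y₃ hlo hlt hhi
        (by have := Nat.one_le_two_pow (n := f); omega) hxlo hxhi) (by omega)
    rw [show 9 * (f + 1) + 14 = 9 * f + 14 + 1 + 1 + 1 + 1 + 1 + 1 + 1 + 1 + 1 by ring]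
    rw [pow_succ] at hf
    have hmid := hmem ((lo + hi) / 2) (by omega) (by omega)
    refine .natSub rfl rfl (show hi - lo ≤ W by omega) ?_
    refine .jumpNatLt_neg rfl hd ?_
    refine .natAdd rfl rfl (show lo + hi ≤ W by omega) ?_
    refine .natDiv rfl rfl (show 2 ≠ 0 by omega) (show (lo + hi) / 2 ≤ W by omega) ?_
    refine .natLoad rfl rfl (show mem ((lo + hi) / 2) ≤ W by omega) ?_
    refine .realData rfl rfl hmid ?_
    by_cases h : v ⟨mem ((lo + hi) / 2), hmid⟩ < x
    · refine .jumpRealLt_pos rfl h ?_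
      refine .natAdd rfl rfl (show (lo + hi) / 2 + 0 ≤ W by omega) ?_
      exact .jump rfl (ih ((lo + hi) / 2) hi _ _ _ _ _ _ _ _ (by omega) (by omega) hhi (by omega)
        (by rwa [recordAt_of_lt v hmid]) hxhi)
    · refine .jumpRealLt_neg rfl h ?_
      refine .natAdd rfl rfl (show (lo + hi) / 2 + 0 ≤ W by omega) ?_
      exact .jump rfl (ih lo ((lo + hi) / 2) _ _ _ _ _ _ _ _ hlo (by omega) (by omega) (by omega)
        hxlo (by rw [recordAt_of_lt v hmid]; exact not_lt.1 h))

theorem chordEvaluation_halts (hnW : 4 * n ≤ W) (heW : e + e ≤ W) (he : 2 ≤ e) (hm0 : mem 0 = e)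
    (hmem : ∀ j, 1 ≤ j → j ≤ e → mem j < n) :
    chordEvaluation.HaltsWithin W v ⟨0, fun _ => 0, Function.update (fun _ => 0) 0 x, mem⟩
      (9 * (Nat.log 2 e + 1) + 23) fun c => ChordValue (recordAt v) mem e x (c.real 0) := by
  have hn1 := hmem 1 le_rfl (by omega)
  have hn2 := hmem e (by omega) le_rfl
  rw [regs_zero 9, regs_cons x 3]
  rw [show 9 * (Nat.log 2 e + 1) + 23 =
    9 * (Nat.log 2 e + 1) + 14 + 1 + 1 + 1 + 1 + 1 + 1 + 1 + 1 + 1 by ring]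
  refine .natConst rfl rfl (show 1 ≤ W by omega) ?_
  refine .natLoad rfl rfl (show mem 0 ≤ W by omega) ?_
  change chordEvaluation.HaltsWithin W v
    ⟨2, regs [0, 1, mem 0, 0, 0, 0, 0, 0, 0], regs [x, 0, 0, 0], mem⟩ _ _
  rw [hm0]
  refine .natConst rfl rfl (show 2 ≤ W by omega) ?_
  refine .natLoad rfl rfl (show mem 1 ≤ W by omega) ?_
  refine .realData rfl rfl hn1 ?_
  by_cases h1 : v ⟨mem 1, hn1⟩ < x
  · refine .jumpRealLt_pos rfl h1 ?_
    refine .natLoad rfl rfl (show mem e ≤ W by omega) ?_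
    refine .realData rfl rfl hn2 ?_
    by_cases h2 : v ⟨mem e, hn2⟩ < x
    · refine .jumpRealLt_pos rfl h2 ?_
      refine .mono (k := 0 + 1) ?_ (by omega)
      refine .realOfNat rfl rfl ?_
      refine .halt rfl (.inr (.inl ⟨?_, rfl⟩))
      rwa [recordAt_of_lt v hn2]
    · refine .jumpRealLt_neg rfl h2 ?_
      refine chordEvaluation_loop hnW heW hmem (Nat.log 2 e + 1) 1 e _ _ _ _ _ _ _ _ le_rfl
        (by omega) le_rfl ?_ (by rwa [recordAt_of_lt v hn1])
        (by rw [recordAt_of_lt v hn2]; exact not_lt.1 h2)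
      have := (Nat.lt_pow_succ_log_self (b := 2) (by norm_num) e).le
      rw [Nat.succ_eq_add_one] at this
      omega
  · refine .jumpRealLt_neg rfl h1 ?_
    refine .realConst rfl rfl ?_
    refine .halt rfl (.inl ⟨?_, rfl⟩)
    rw [recordAt_of_lt v hn1]
    exact not_lt.1 h1

end Evaluation

/-! ### Learnability of distributions with a piecewise linear distribution function -/

theorem abs_chordValue_sub_rankFun_le {n s τ e : ℕ} {v : Fin n → ℝ} (hv : Monotone v)
    (hI : ∀ i, v i ∈ Icc (0 : ℝ) 1) {mem : ℕ → ℕ} (hm1 : mem 1 = 0) (hend : n ≤ mem e + s)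
    (hlinks : Links (GoodLink (recordAt v) n s τ) mem e) {x y : ℝ} (hx : x ≤ 1)
    (hy : ChordValue (recordAt v) mem e x y) : |y - rankFun v x| ≤ τ + s := by
  have hτ : (0 : ℝ) ≤ τ := Nat.cast_nonneg τ
  have hs : (0 : ℝ) ≤ s := Nat.cast_nonneg s
  have h0 : 0 ≤ rankFun v x := Nat.cast_nonneg _
  rcases hy with ⟨hx1, rfl⟩ | ⟨hx1, rfl⟩ | ⟨j, hj, hje, hx1, hx2, rfl⟩
  · have := rankFun_le_of_le_recordAt hv hx1
    rw [hm1, Nat.cast_zero] at this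
    rw [show rankFun v x = 0 by linarith, sub_zero, abs_zero]
    positivity
  · have h1 := lt_rankFun_of_recordAt_lt hv hx hx1
    have h2 : rankFun v x ≤ n := by
      rw [rankFun]
      exact_mod_cast (Finset.card_le_univ _).trans (by simp)
    have h3 : (n : ℝ) ≤ mem e + s := by exact_mod_cast hend
    rw [abs_le]
    constructor <;> linarith
  · exact abs_chord_sub_rankFun_le hv hI (hlinks j hj hje) hx hx1 hx2

/-- Only the average has to have few pieces; the breakpoints of the individual members play no role.
-/
theorem distRankFun_eq_averageDist {n : ℕ} (hn : 1 ≤ n) (χ : Fin n → Measure ℝ)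
    [∀ i, IsProbabilityMeasure (χ i)] (x : ℝ) :
    distRankFun χ x = n * distFun (averageDist χ) x := by
  have hn' : (n : ℝ) ≠ 0 := by positivity
  rw [distRankFun_eq_sum, distFun, averageDist, Measure.smul_apply, Measure.finsetSum_apply,
    smul_eq_mul, ENNReal.toReal_mul, ENNReal.toReal_inv, ENNReal.toReal_natCast,
    ENNReal.toReal_sum fun i _ => measure_ne_top _ _, mul_inv_cancel_left₀ hn']
  rfl

/-- Here the constants `5` and `4` arise. Either `τ = s ≤ 2 √n`, or `τ` is twice a rejected
tolerance and so less than `4 δ`. The chord errs by `τ + s`, and passing to the distribution rank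
function adds `δ`. -/
theorem abs_distRankFun_sub_chordValue_le {n l s τ e : ℕ} (hn : 1 ≤ n) {χ : Fin n → Measure ℝ}
    (hχ : χ ∈ averagedFamiliesIn (PiecewiseLinearCDF l) n) {v : Fin n → ℝ} (hv : Monotone v)
    (hI : ∀ i, v i ∈ Icc (0 : ℝ) 1) (hs : (s : ℝ) ≤ 2 * √(n : ℝ)) {mem : ℕ → ℕ}
    (hτ : MinimalTolerance (recordAt v) n s (4 * l + 9) τ) (hm1 : mem 1 = 0)
    (hend : n ≤ mem e + s) (hlinks : Links (GoodLink (recordAt v) n s τ) mem e) {δ x y : ℝ}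
    (hδ : ∀ x, |rankFun v x - distRankFun χ x| ≤ δ) (hx : x ≤ 1)
    (hy : ChordValue (recordAt v) mem e x y) :
    |distRankFun χ x - y| ≤ 5 * δ + 4 * √(n : ℝ) := by
  have := fun i => (hχ.1 i).1.1
  obtain ⟨-, t, ht, ht0, htl, hlin⟩ := hχ.2
  have hlin' : ∀ i < l, ∃ A B : ℝ, ∀ x ∈ Ioo (t i) (t (i + 1)), distRankFun χ x = A * x + B := by
    intro i hi
    obtain ⟨A, B, h⟩ := hlin i hi
    refine ⟨n * A, n * B, fun x hx => ?_⟩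
    rw [distRankFun_eq_averageDist hn, h x hx]
    ring
  have h1 := abs_chordValue_sub_rankFun_le hv hI hm1 hend hlinks hx hy
  have h2 := hδ x
  have hδ0 := (abs_nonneg _).trans (hδ 0)
  have h3 : (τ : ℝ) + s ≤ 4 * δ + 4 * √(n : ℝ) := by
    rcases hτ with rfl | ⟨τ', q, rfl, hq⟩
    · linarith
    · have := lt_two_mul_of_links hv hI hδ ht ht0 htl hlin' hq
      push_cast
      linarith [Real.sqrt_nonneg (n : ℝ)]
  rw [abs_le] at h1 h2 ⊢
  constructor <;> linarith

/-- The numerical estimates for the size of a chord model, the time to compute it and the time to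
evaluate it. -/
theorem chord_estimates {n l : ℕ} (hn : 1 ≤ n) (hl : 1 ≤ l) :
    ((40 * (roundFuel (n.sqrt + 1) 0 1 0 * (Nat.log 2 n + 3)) + 4 * (n.sqrt + 1) + 60 : ℕ) : ℝ) ≤
      6000 * (n * Real.log (n + 1)) ∧
    37 + (4 * l + 9 + 1 + (4 * l + 9) * (Nat.log 2 n + 1) : ℕ) ≤ 6000 * (l * Real.log (n + 1)) ∧
    ((9 * (Nat.log 2 (4 * l + 9) + 1) + 23 : ℕ) : ℝ) ≤ 6000 * Real.log (l + 1) := by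
  have hn' : (1 : ℝ) ≤ n := by exact_mod_cast hn
  have hl' : (1 : ℝ) ≤ l := by exact_mod_cast hl
  have hq : (1 : ℝ) ≤ √(n : ℝ) := Real.one_le_sqrt.2 hn'
  have hqq : √(n : ℝ) * √(n : ℝ) = n := Real.mul_self_sqrt (by linarith)
  have hσ := cast_sqrt_le n
  have hlg : (Nat.log 2 n : ℝ) ≤ 1.5 * Real.log (n + 1) := natLog_two_le
  have hlog := le_log_add_one hn
  have hlogl := le_log_add_one hl
  have hnlog : (n : ℝ) * 0.69 ≤ n * Real.log (n + 1) := by gcongr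
  have hllog : (l : ℝ) * 0.69 ≤ l * Real.log (n + 1) := by gcongr
  refine ⟨?_, ?_, ?_⟩
  · have h1 : ((roundFuel (n.sqrt + 1) 0 1 0 : ℕ) : ℝ) ≤ 21 * n := by
      simp only [roundFuel, Nat.add_sub_cancel, zero_add, lt_irrefl, if_false]
      push_cast
      have : ((n.sqrt : ℝ) + 1) * (2 * (n.sqrt + 1) + 6) ≤
          (2 * √(n : ℝ)) * (10 * √(n : ℝ)) := by
        gcongr <;> linarith
      norm_num
      nlinarith
    have h2 : ((roundFuel (n.sqrt + 1) 0 1 0 : ℕ) : ℝ) * (Nat.log 2 n + 3) ≤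
        (21 * n) * (6 * Real.log (n + 1)) := by
      gcongr
      linarith
    have h3 : √(n : ℝ) ≤ n := by nlinarith
    push_cast
    linarith
  · have h1 : (4 * l + 9 : ℝ) * (Nat.log 2 n + 2) ≤ (13 * l) * (5 * Real.log (n + 1)) := by
      gcongr <;> linarith
    push_cast
    linarith
  · have h1 : (Nat.log 2 (4 * l + 9) : ℝ) ≤ 1.5 * Real.log ((4 * l + 9 : ℕ) + 1) := natLog_two_le
    -- Since `l ≥ 1`, one has `4 l + 10 ≤ 16 (l + 1) ≤ (l + 1) ^ 5`.
    have h2 : Real.log ((4 * l + 9 : ℕ) + 1) ≤ 5 * Real.log (l + 1) := by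
      have h3 : (5 : ℝ) * Real.log (l + 1) = Real.log ((l + 1) ^ 5) := by
        rw [Real.log_pow]; norm_num
      rw [h3]
      refine Real.log_le_log (by positivity) ?_
      have h4 : (2 : ℝ) ^ 4 ≤ (l + 1) ^ 4 := by gcongr; linarith
      push_cast
      calc (4 * l + 9 + 1 : ℝ) ≤ 2 ^ 4 * (l + 1) := by linarith
        _ ≤ (l + 1) ^ 4 * (l + 1) := by gcongr
        _ = (l + 1) ^ 5 := by ring
    push_cast
    linarith

theorem rankLearnable_piecewiseLinearCDF {C : ℕ} (hC : 6000 ≤ C) {l : ℕ} (hl : 1 ≤ l) :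
    RankLearnable 8 (1 / 3200) C (averagedFamiliesIn (PiecewiseLinearCDF l))
      (fun _ => Real.log (l + 1))
      (fun n => l * Real.log (n + 1))
      (fun n => n * Real.log (n + 1) / n) := by
  refine rankLearnable_of_forall_dataset (chordTraining (4 * l + 9)) chordEvaluation
    (fun n χ hχ i => (hχ.1 i).1) fun n hn v hv hI => ?_
  have hn' : (1 : ℝ) ≤ n := by exact_mod_cast hn
  have hl' : (1 : ℝ) ≤ l := by exact_mod_cast hl
  have hC' : (6000 : ℝ) ≤ C := by exact_mod_cast hC
  have hlog := le_log_add_one hn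
  have hlogl := le_log_add_one hl
  have hS : (l : ℝ) * 0.69 ≤ l * Real.log (n + 1) := by gcongr
  generalize hWdef : ⌊((n : ℝ) + l * Real.log (n + 1)) ^ C⌋₊ = W
  have hW : ∀ m : ℕ, (m : ℝ) ≤ 100 * (l * n) → m ≤ W := fun m hm => by
    rw [← hWdef]; exact le_floor_pow hn hl' hS (by omega) hm
  have hln : (l : ℝ) ≤ l * n := by nlinarith
  have hnl : (n : ℝ) ≤ l * n := by nlinarith
  have hKW : 2 * (4 * l + 10) ≤ W := hW _ (by push_cast; linarith)
  have hnW : 4 * n ≤ W := hW _ (by push_cast; linarith)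
  obtain ⟨k, hk, s', hs', s, hs1, hns, hsn, τ, e, hτ, he2, heK, hL, hm0, hm1, hen, hend, hmon,
    hlinks⟩ := chordTraining_halts (K := 4 * l + 9) (W := W) hn hv hI (by omega) (by omega) hnW
  have hsq : (s : ℝ) ≤ 2 * √(n : ℝ) := by
    linarith [cast_le_sqrt_add_one hsn, Real.one_le_sqrt.2 hn']
  obtain ⟨hE1, hE2, hE3⟩ := chord_estimates hn hl
  refine ⟨_, k, ⟨s', hs', rfl⟩, ?_, ?_, fun x hx => ?_⟩
  · have h1 : (k : ℝ) ≤ _ := Nat.cast_le.2 hk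
    rw [mul_div_cancel₀ _ (by positivity)]
    exact h1.trans (hE1.trans (by gcongr))
  · have h1 : bitSize ((List.range (s'.nat 0)).map s'.mem) ≤
        4 * l + 9 + 1 + (4 * l + 9) * (Nat.log 2 n + 1) := by
      rw [hL]
      refine (bitSize_map_range_succ_le (b := Nat.log 2 n + 1) fun i hi => ?_).trans ?_
      · have := hmon (i + 1) (by omega) (by omega)
        exact Nat.succ_le_succ (Nat.log_mono_right (by omega))
      · rw [hm0]
        gcongr
    have h2 : ((bitSize ((List.range (s'.nat 0)).map s'.mem) : ℕ) : ℝ) ≤ _ := Nat.cast_le.2 h1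
    refine (add_le_add_right h2 _).trans ((le_of_eq ?_).trans (hE2.trans (by gcongr)))
    norm_num [chordEvaluation]
  · have hget : ∀ i ≤ e, ((List.range (s'.nat 0)).map s'.mem).getD i 0 = s'.mem i :=
      fun i hi => getD_map_range _ (by omega)
    obtain ⟨j, hj, c, hc, hy⟩ := chordEvaluation_halts (W := W) (v := v) (x := x) (e := e)
      (mem := fun i => ((List.range (s'.nat 0)).map s'.mem).getD i 0) hnW (by omega) he2
      ((hget 0 (by omega)).trans hm0) fun j hj hje => by
        rw [hget j hje]
        exact (hmon j hj hje).trans_lt hen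
    refine ⟨j, _, ⟨c, hc, rfl⟩, ?_, fun χ hχ δ hδ => ?_⟩
    · have h1 : j ≤ 9 * (Nat.log 2 (4 * l + 9) + 1) + 23 := by
        have := Nat.log_mono_right (b := 2) heK
        omega
      have h2 : (j : ℝ) ≤ _ := Nat.cast_le.2 h1
      exact h2.trans (hE3.trans (by gcongr))
    · refine abs_distRankFun_sub_chordValue_le (e := e)
        (mem := fun i => ((List.range (s'.nat 0)).map s'.mem).getD i 0) hn hχ hv hI hsq hτ
        ((hget 1 (by omega)).trans hm1) ?_ ?_ hδ hx.2 hy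
      · rw [hget e le_rfl]; exact hend
      · intro j hj hje
        have h := hlinks j hj hje
        rwa [← hget j hje.le, ← hget (j + 1) hje] at h

/-! ### The three classes with common constants. -/

theorem mainTheorem8 :
    ∃ (κ₁ κ₂ : ℝ) (C : ℕ), 0 < κ₁ ∧ 0 < κ₂ ∧
      (∀ ρ : ℝ, 1 ≤ ρ →
        RankLearnable κ₁ κ₂ C (familiesIn (BoundedDensity ρ))
          (fun _ => 1)
          (fun n => ρ * √(n : ℝ) * Real.log (n + 1))
          (fun n => ρ * √(n : ℝ) * Real.log (n + 1) / n)) ∧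
      (∀ l : ℕ, 1 ≤ l →
        RankLearnable κ₁ κ₂ C (averagedFamiliesIn (PiecewiseLinearCDF l))
          (fun _ => Real.log (l + 1))
          (fun n => l * Real.log (n + 1))
          (fun n => n * Real.log (n + 1) / n)) ∧
      (∀ μ : Measure ℝ, ConstantTimeCDF μ →
        ∃ C' : ℕ, RankLearnable κ₁ κ₂ C' (familiesIn {μ})
          (fun _ => 1) (fun _ => 1) (fun n => 1 / n)) :=
  ⟨8, 1 / 3200, 6000, by norm_num, by norm_num,
    fun _ hρ => rankLearnable_boundedDensity (by norm_num) hρ,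
    fun _ hl => rankLearnable_piecewiseLinearCDF le_rfl hl,
    fun _ hμ => exists_rankLearnable_singleton hμ⟩
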